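/- **Conventions.** A $\mu$-component virtual link diagram (ordered and oriented circles immersed in the plane, with classical and virtual crossings) is considered up to planar isotopy and the virtual moves VR1–VR4; equivalently, it is given by its Gauss diagram: $\mu$ ordered oriented circles, on each of them a finite cyclic sequence of passages through classical crossings, where every classical crossing has a sign $\pm1$ and is passed exactly twice, once as overpass and once as underpass. A *$\mu$-component welded link* is an equivalence class of such diagrams under the Reidemeister moves R1, R2, R3 (in all oriented versions) and the move OC, which exchanges two consecutive overpasses. For a welded link $L$ with diagram $D$ and $i\neq j$, the *ordered linking number* $\lambda_{ij}(L)\in\mathbb Z$ is the sum of the signs of all classical crossings of $D$ whose overpass belongs to the $i$th and whose underpass belongs to the $j$th component; it does not depend on the choice of $D$. For an odd positive integer $n$, the *$V(n)$-move* is the local move that replaces two strands oriented in parallel by $n$ successive classical half twists of the two strands, all of the same sign, followed by one virtual crossing (so that each strand ends in its original place); thus $n$ crossings of the same sign are inserted, met in the same order along both strands, at which the two strands are alternately the overpass. Two welded links are *$V(n)$-equivalent* if they have diagrams that are related by a finite sequence of $V(n)$-moves, their inverses and welded Reidemeister moves. **Theorem.** Let $n$ be an odd positive integer. Two $\mu$-component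 welded links $L$ and $L'$ are $V(n)$-equivalent if and only if $$\lambda_{ij}(L)+\lambda_{ji}(L)\equiv\lambda_{ij}(L')+\lambda_{ji}(L')\pmod n\qquad\text{for all } 1\le i<j\le\mu .$$ -/

import Mathlib

/-! Welded links as Gauss diagrams.

A virtual link diagram is determined, up to planar isotopy and the virtual moves VR1, VR2, VR3, VR4
(the detour move), by its Gauss diagram: for each of its ordered oriented circles, the cyclic
sequence of passages through classical crossings.  Conversely every Gauss diagram comes from a
virtual link diagram.  So virtual link diagrams are taken here as Gauss diagrams; virtual crossings
leave no trace, and the moves below are the effects of the local moves of the plane picture. -/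

/-- A passage through a classical crossing: the name of the crossing, whether it is the overpass
(`true`) or the underpass (`false`), and the sign of the crossing. -/
abbrev Passage : Type := ℕ × Bool × ℤˣ

namespace Passage

/-- The overpass of the crossing `x` of sign `ε`. -/
def ov (x : ℕ) (ε : ℤˣ) : Passage := (x, true, ε)

/-- The underpass of the crossing `x` of sign `ε`. -/
def un (x : ℕ) (ε : ℤˣ) : Passage := (x, false, ε)

/-- Whether the passage is an overpass. -/
def isOver (l : Passage) : Bool := l.2.1

/-- The sign of the crossing. -/
def sign (l : Passage) : ℤˣ := l.2.2

/-- Name of the crossing and level of the passage. -/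
def key (l : Passage) : ℕ × Bool := (l.1, l.2.1)

/-- The other passage through the same crossing. -/
def mate (l : Passage) : Passage := (l.1, !l.2.1, l.2.2)

/-- Renaming of crossings. -/
def rename (σ : Equiv.Perm ℕ) (l : Passage) : Passage := (σ l.1, l.2)

end Passage

/-- A Gauss diagram on `μ` ordered oriented circles: `word i` lists the passages met along the
`i`-th circle, in the direction of its orientation, from some base point.  Every crossing is passed
exactly twice, once as overpass and once as underpass, with the same sign. -/
structure GaussDiagram (μ : ℕ) where
  word : Fin μ → List Passage
  nodup : ∀ i, ((word i).map Passage.key).Nodup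
  disjoint : ∀ i j, i ≠ j → ((word i).map Passage.key).Disjoint ((word j).map Passage.key)
  mate_mem : ∀ i, ∀ l ∈ word i, ∃ j, l.mate ∈ word j

/-- A diagram with `k` arcs left open: the `k` symbols `Sum.inr h` stand for pairwise disjoint arcs
of the circles. -/
abbrev OpenDiagram (μ k : ℕ) : Type := Fin μ → List (Passage ⊕ Fin k)

/-- Insert the sequences of passages `f h` into the open arcs. -/
def OpenDiagram.fill {μ k : ℕ} (W : OpenDiagram μ k) (f : Fin k → List Passage) :
    Fin μ → List Passage :=
  fun i => (W i).flatMap (Sum.elim (fun l => [l]) f)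

/-- `D'` arises from `D` by replacing, along `k` disjoint arcs (the strands that take part in a
local move), the passages `f` by the passages `f'`; nothing else is changed. -/
def LocalChange {μ k : ℕ} (f f' : Fin k → List Passage) (D D' : GaussDiagram μ) : Prop :=
  ∃ W : OpenDiagram μ k, (∀ h, ∑ i, (W i).countP (fun s => s = Sum.inr h) = 1) ∧
    D.word = W.fill f ∧ D'.word = W.fill f'

/-- Two passages, met in the order `a`, `b` if `ε = 1` and in the order `b`, `a` if `ε = -1`. -/
def ordered (ε : ℤˣ) (a b : Passage) : List Passage := if ε = 1 then [a, b] else [b, a]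

open Passage in
/-- One generating step of welded isotopy. -/
inductive WeldedMove {μ : ℕ} (D D' : GaussDiagram μ) : Prop
  /-- Change of the base point on the `i`-th circle (the same Gauss diagram). -/
  | rotate (i : Fin μ) (u v : List Passage) (h : D.word i = u ++ v) (h' : D'.word i = v ++ u)
      (hj : ∀ j, j ≠ i → D'.word j = D.word j)
  /-- Renaming of the crossings (the same Gauss diagram). -/
  | rename (σ : Equiv.Perm ℕ) (h : ∀ i, D'.word i = (D.word i).map (Passage.rename σ))
  /-- R1, the strand first passing over. -/
  | r1_over (x : ℕ) (ε : ℤˣ) (h : LocalChange ![[]] ![[ov x ε, un x ε]] D D')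
  /-- R1, the strand first passing under. -/
  | r1_under (x : ℕ) (ε : ℤˣ) (h : LocalChange ![[]] ![[un x ε, ov x ε]] D D')
  /-- R2, the two strands oriented in parallel. -/
  | r2_parallel (x y : ℕ) (ε : ℤˣ)
      (h : LocalChange ![[], []] ![[ov x ε, ov y (-ε)], [un x ε, un y (-ε)]] D D')
  /-- R2, the two strands oriented antiparallel. -/
  | r2_antiparallel (x y : ℕ) (ε : ℤˣ)
      (h : LocalChange ![[], []] ![[ov x ε, ov y (-ε)], [un y (-ε), un x ε]] D D')
  /-- R3.  The top strand crosses the middle strand in `x` (sign `α`) and the bottom strand in `y`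
  (sign `β`), the middle strand crosses the bottom strand in `z` (sign `γ`).  The eight choices of
  signs are the eight oriented versions of the move, and the signs determine in which order the
  crossings are met along the three strands; the move reverses all three orders. -/
  | r3 (x y z : ℕ) (α β γ : ℤˣ)
      (h : LocalChange
        ![ordered β (ov x α) (ov y β),
          ordered γ (un x α) (ov z γ),
          ordered (α * β * γ) (un y β) (un z γ)]
        ![ordered (-β) (ov x α) (ov y β),
          ordered (-γ) (un x α) (ov z γ),
          ordered (-(α * β * γ)) (un y β) (un z γ)] D D')
  /-- OC: consecutive overpasses commute. -/
  | oc (x y : ℕ) (α β : ℤˣ)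
      (h : LocalChange ![[ov x α, ov y β]] ![[ov y β, ov x α]] D D')

open Passage in
/-- The `V(n)`-move for odd `n`.  Two strands oriented in parallel are replaced by the strands of
`n` successive half twists of the same sign, followed by a virtual crossing that leads the strands
back to their places (as `n` is odd).  Along both strands the `n` crossings `x 0, …, x (n - 1)` are
met in this order; each strand passes alternately over and under. -/
def VMove {μ : ℕ} (n : ℕ) (D D' : GaussDiagram μ) : Prop :=
  ∃ (x : ℕ → ℕ) (ε : ℤˣ), LocalChange ![[], []]
    ![(List.range n).map (fun k => if Even k then ov (x k) ε else un (x k) ε),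
      (List.range n).map (fun k => if Even k then un (x k) ε else ov (x k) ε)] D D'

/-- Diagrams up to welded isotopy. -/
instance weldedSetoid (μ : ℕ) : Setoid (GaussDiagram μ) := Relation.EqvGen.setoid WeldedMove

/-- A `μ`-component welded link: a welded isotopy class of diagrams. -/
def WeldedLink (μ : ℕ) : Type := Quotient (weldedSetoid μ)

/-- `D` is a diagram of `L`. -/
def IsDiagramOf {μ : ℕ} (D : GaussDiagram μ) (L : WeldedLink μ) : Prop :=
  Quotient.mk (weldedSetoid μ) D = L

/-- Two welded links are `V(n)`-equivalent (`n` odd) if they have diagrams that are related by a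
finite sequence of `V(n)`-moves and welded Reidemeister moves, in either direction. -/
def VEquivalent {μ : ℕ} (n : ℕ) (L L' : WeldedLink μ) : Prop :=
  ∃ D D' : GaussDiagram μ, IsDiagramOf D L ∧ IsDiagramOf D' L' ∧
    Relation.EqvGen (fun E E' => WeldedMove E E' ∨ VMove n E E') D D'

/-- The overpasses on the `i`-th circle whose underpass lies on the `j`-th circle. -/
def GaussDiagram.overpasses {μ : ℕ} (D : GaussDiagram μ) (i j : Fin μ) : Finset Passage :=
  (D.word i).toFinset.filter (fun l => l.isOver = true ∧ l.mate ∈ D.word j)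

/-- The sum of the signs of all classical crossings whose overpass belongs to the `i`-th and whose
underpass belongs to the `j`-th component. -/
def GaussDiagram.linking {μ : ℕ} (D : GaussDiagram μ) (i j : Fin μ) : ℤ :=
  ∑ l ∈ D.overpasses i j, (l.sign : ℤ)

theorem GaussDiagram.mem_overpasses {μ : ℕ} (D : GaussDiagram μ) (i j : Fin μ) (l : Passage) :
    l ∈ D.overpasses i j ↔ l ∈ D.word i ∧ l.isOver = true ∧ l.mate ∈ D.word j := by
  simp [GaussDiagram.overpasses]

theorem GaussDiagram.linking_congr {μ : ℕ} {D D' : GaussDiagram μ}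
    (h : ∀ i l, l ∈ D.word i ↔ l ∈ D'.word i) (i j : Fin μ) :
    D.linking i j = D'.linking i j := by
  have : D.overpasses i j = D'.overpasses i j := by
    ext l
    simp only [GaussDiagram.mem_overpasses, h]
  rw [GaussDiagram.linking, GaussDiagram.linking, this]

theorem GaussDiagram.eq_of_key {μ : ℕ} (D : GaussDiagram μ) {i j : Fin μ} {l l' : Passage}
    (h : l ∈ D.word i) (h' : l' ∈ D.word j) (hk : l.key = l'.key) : i = j := by
  by_contra hij
  exact D.disjoint i j hij (List.mem_map_of_mem h) (hk ▸ List.mem_map_of_mem h')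

theorem OpenDiagram.mem_fill {μ k : ℕ} (W : OpenDiagram μ k) (f : Fin k → List Passage)
    (i : Fin μ) (l : Passage) :
    l ∈ W.fill f i ↔ Sum.inl l ∈ W i ∨ ∃ h, Sum.inr h ∈ W i ∧ l ∈ f h := by
  simp [OpenDiagram.fill, List.mem_flatMap]

theorem OpenDiagram.exists_mem {μ k : ℕ} {W : OpenDiagram μ k}
    (hW : ∀ h, ∑ i, (W i).countP (fun s => s = Sum.inr h) = 1) (h : Fin k) :
    ∃ i, Sum.inr h ∈ W i := by
  obtain ⟨i, -, hi⟩ := Finset.exists_ne_zero_of_sum_ne_zero (by rw [hW h]; exact one_ne_zero)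
  obtain ⟨s, hs, hs'⟩ := List.countP_pos_iff.1 (Nat.pos_of_ne_zero hi)
  exact ⟨i, by simpa using (of_decide_eq_true hs') ▸ hs⟩

theorem OpenDiagram.fresh {μ k : ℕ} {W : OpenDiagram μ k} {f : Fin k → List Passage}
    {D : GaussDiagram μ} (hD : D.word = W.fill f) {i j : Fin μ} {l l' : Passage} {h : Fin k}
    (hl : Sum.inl l ∈ W i) (hh : Sum.inr h ∈ W j) (hl' : l' ∈ f h) : l.key ≠ l'.key := by
  intro hk
  have h1 : l ∈ D.word i := by rw [hD, OpenDiagram.mem_fill]; exact Or.inl hl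
  have h2 : l' ∈ D.word j := by rw [hD, OpenDiagram.mem_fill]; exact Or.inr ⟨h, hh, hl'⟩
  obtain rfl := D.eq_of_key h1 h2 hk
  have h3 := D.nodup i
  rw [hD, OpenDiagram.fill, List.map_flatMap, List.nodup_flatMap] at h3
  have h4 := h3.2
  have hsymm : Std.Symm (Function.onFun List.Disjoint fun a : Passage ⊕ Fin k =>
      List.map Passage.key (Sum.elim (fun l => [l]) f a)) :=
    ⟨fun a b hab => List.Disjoint.symm hab⟩
  have h5 := h4.forall hl hh Sum.inl_ne_inr
  exact h5 (a := l.key) (by simp) (by rw [hk]; exact List.mem_map_of_mem hl')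

theorem Passage.mate_mate (l : Passage) : l.mate.mate = l := by
  simp [Passage.mate]

theorem Passage.mate_inj {l l' : Passage} : l.mate = l'.mate ↔ l = l' :=
  ⟨fun h => by rw [← l.mate_mate, h, l'.mate_mate], fun h => h ▸ rfl⟩

/-- The overpasses after an insertion of crossings. -/
theorem GaussDiagram.mem_overpasses_insert {μ k : ℕ} {W : OpenDiagram μ k}
    {f f' : Fin k → List Passage} {D D' : GaussDiagram μ}
    (hW : ∀ h, ∑ i, (W i).countP (fun s => s = Sum.inr h) = 1)
    (hD : D.word = W.fill f) (hD' : D'.word = W.fill f') (hf : ∀ h, f h = [])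
    (hm : ∀ h, ∀ l ∈ f' h, ∃ h', l.mate ∈ f' h') (i j : Fin μ) (l : Passage) :
    l ∈ D'.overpasses i j ↔ l ∈ D.overpasses i j ∨
      (l.isOver = true ∧ ∃ h h', Sum.inr h ∈ W i ∧ Sum.inr h' ∈ W j ∧
        l ∈ f' h ∧ l.mate ∈ f' h') := by
  simp only [GaussDiagram.mem_overpasses, hD, hD', OpenDiagram.mem_fill, hf, List.not_mem_nil,
    and_false, exists_false, or_false]
  constructor
  · rintro ⟨h1 | ⟨h, hh, h1⟩, h2, h3 | ⟨h', hh', h3⟩⟩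
    · exact Or.inl ⟨h1, h2, h3⟩
    · obtain ⟨h'', h4⟩ := hm _ _ h3
      rw [Passage.mate_mate] at h4
      obtain ⟨a, ha⟩ := OpenDiagram.exists_mem hW h''
      exact (OpenDiagram.fresh hD' h1 ha h4 rfl).elim
    · obtain ⟨h'', h4⟩ := hm _ _ h1
      obtain ⟨a, ha⟩ := OpenDiagram.exists_mem hW h''
      exact (OpenDiagram.fresh hD' h3 ha h4 rfl).elim
    · exact Or.inr ⟨h2, h, h', hh, hh', h1, h3⟩
  · rintro (⟨h1, h2, h3⟩ | ⟨h2, h, h', hh, hh', h1, h3⟩)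
    · exact ⟨Or.inl h1, h2, Or.inl h3⟩
    · exact ⟨Or.inr ⟨h, hh, h1⟩, h2, Or.inr ⟨h', hh', h3⟩⟩

theorem GaussDiagram.linking_r1 {μ : ℕ} {f f' : Fin 1 → List Passage} {D D' : GaussDiagram μ}
    (hf : ∀ h, f h = []) (x : ℕ) (ε : ℤˣ)
    (hf' : ∀ h l, l ∈ f' h ↔ l = Passage.ov x ε ∨ l = Passage.un x ε)
    (h : LocalChange f f' D D') {i j : Fin μ} (hij : i ≠ j) :
    D.linking i j = D'.linking i j := by
  obtain ⟨W, hW, hD, hD'⟩ := h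
  have hov : (Passage.ov x ε).mate = Passage.un x ε := rfl
  have hun : (Passage.un x ε).mate = Passage.ov x ε := rfl
  have key := GaussDiagram.mem_overpasses_insert hW hD hD' hf (by
    intro h l hl
    refine ⟨h, ?_⟩
    rw [hf'] at hl ⊢
    rcases hl with rfl | rfl
    · exact Or.inr rfl
    · exact Or.inl rfl) i j
  have : D.overpasses i j = D'.overpasses i j := by
    ext l
    rw [key]
    refine ⟨Or.inl, ?_⟩
    rintro (h | ⟨-, a, b, ha, hb, -, -⟩)
    · exact h
    · exfalso
      obtain rfl : a = b := Subsingleton.elim _ _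
      have hmem : Passage.ov x ε ∈ f' a := (hf' _ _).2 (Or.inl rfl)
      refine hij (D'.eq_of_key (l := Passage.ov x ε) (l' := Passage.ov x ε) ?_ ?_ rfl)
      · rw [hD', OpenDiagram.mem_fill]; exact Or.inr ⟨a, ha, hmem⟩
      · rw [hD', OpenDiagram.mem_fill]; exact Or.inr ⟨a, hb, hmem⟩
  rw [GaussDiagram.linking, GaussDiagram.linking, this]

theorem GaussDiagram.linking_r2 {μ : ℕ} {f f' : Fin 2 → List Passage} {D D' : GaussDiagram μ}
    (hf : ∀ h, f h = []) (x y : ℕ) (ε : ℤˣ)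
    (hf0 : ∀ l, l ∈ f' 0 ↔ l = Passage.ov x ε ∨ l = Passage.ov y (-ε))
    (hf1 : ∀ l, l ∈ f' 1 ↔ l = Passage.un x ε ∨ l = Passage.un y (-ε))
    (h : LocalChange f f' D D') (i j : Fin μ) :
    D.linking i j = D'.linking i j := by
  obtain ⟨W, hW, hD, hD'⟩ := h
  have key := GaussDiagram.mem_overpasses_insert hW hD hD' hf (by
    intro h l hl
    rcases h with ⟨_ | _ | h, hh⟩
    · refine ⟨1, ?_⟩
      rw [hf1]
      rcases (hf0 l).1 hl with rfl | rfl
      · exact Or.inl rfl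
      · exact Or.inr rfl
    · refine ⟨0, ?_⟩
      rw [hf0]
      rcases (hf1 l).1 hl with rfl | rfl
      · exact Or.inl rfl
      · exact Or.inr rfl
    · omega) i j
  have hnew : ∀ l : Passage, (l.isOver = true ∧ ∃ h h', Sum.inr h ∈ W i ∧ Sum.inr h' ∈ W j ∧
        l ∈ f' h ∧ l.mate ∈ f' h') ↔ (Sum.inr 0 ∈ W i ∧ Sum.inr 1 ∈ W j) ∧
          (l = Passage.ov x ε ∨ l = Passage.ov y (-ε)) := by
    intro l
    constructor
    · rintro ⟨h1, a, b, ha, hb, hla, hlb⟩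
      fin_cases a
      · have hl := (hf0 l).1 hla
        fin_cases b
        · exfalso
          have hl' := (hf0 _).1 hlb
          rcases hl with rfl | rfl <;> simp [Passage.ov, Passage.mate] at hl'
        · exact ⟨⟨ha, hb⟩, hl⟩
      · exfalso
        rcases (hf1 l).1 hla with rfl | rfl <;> simp [Passage.un, Passage.isOver] at h1
    · rintro ⟨⟨ha, hb⟩, hl⟩
      refine ⟨?_, 0, 1, ha, hb, (hf0 l).2 hl, (hf1 _).2 ?_⟩
      · rcases hl with rfl | rfl <;> rfl
      · rcases hl with rfl | rfl
        · exact Or.inl rfl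
        · exact Or.inr rfl
  simp only [hnew] at key
  by_cases hc : (Sum.inr 0 ∈ W i ∧ Sum.inr 1 ∈ W j)
  · simp only [hc, and_self, true_and] at key
    have hold : ∀ l, l = Passage.ov x ε ∨ l = Passage.ov y (-ε) → l ∉ D.overpasses i j := by
      intro l hl hlD
      rw [GaussDiagram.mem_overpasses, hD, OpenDiagram.mem_fill] at hlD
      simp only [hf, List.not_mem_nil, and_false, exists_false, or_false] at hlD
      exact OpenDiagram.fresh hD' hlD.1 hc.1 ((hf0 l).2 hl) rfl
    have hne : Passage.ov x ε ≠ Passage.ov y (-ε) := by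
      intro h
      exact units_ne_neg_self ε (congrArg (fun l : Passage => l.2.2) h)
    have hset : D'.overpasses i j =
        insert (Passage.ov x ε) (insert (Passage.ov y (-ε)) (D.overpasses i j)) := by
      ext l
      rw [key, Finset.mem_insert, Finset.mem_insert]
      tauto
    rw [GaussDiagram.linking, GaussDiagram.linking, hset, Finset.sum_insert, Finset.sum_insert]
    · simp [Passage.ov, Passage.sign]
    · exact hold _ (Or.inr rfl)
    · rw [Finset.mem_insert, not_or]
      exact ⟨hne, hold _ (Or.inl rfl)⟩
  · have : D.overpasses i j = D'.overpasses i j := by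
      ext l
      rw [key]
      tauto
    rw [GaussDiagram.linking, GaussDiagram.linking, this]

theorem GaussDiagram.linking_localChange {μ k : ℕ} {f f' : Fin k → List Passage}
    {D D' : GaussDiagram μ} (hf : ∀ h l, l ∈ f h ↔ l ∈ f' h) (h : LocalChange f f' D D')
    (i j : Fin μ) : D.linking i j = D'.linking i j := by
  obtain ⟨W, hW, hD, hD'⟩ := h
  refine GaussDiagram.linking_congr (fun i l => ?_) i j
  simp only [hD, hD', OpenDiagram.mem_fill, hf]

theorem mem_ordered (ε : ℤˣ) (a b l : Passage) : l ∈ ordered ε a b ↔ l = a ∨ l = b := by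
  unfold ordered
  split_ifs <;> simp [or_comm]

theorem GaussDiagram.linking_rename {μ : ℕ} {D D' : GaussDiagram μ} (σ : Equiv.Perm ℕ)
    (h : ∀ i, D'.word i = (D.word i).map (Passage.rename σ)) (i j : Fin μ) :
    D.linking i j = D'.linking i j := by
  have hinj : Function.Injective (Passage.rename σ) := by
    rintro ⟨a, b⟩ ⟨c, d⟩ hac
    simpa [Passage.rename] using hac
  have hmate : ∀ l : Passage, (Passage.rename σ l).mate = Passage.rename σ l.mate := fun _ => rfl
  have hset : D'.overpasses i j = (D.overpasses i j).map ⟨Passage.rename σ, hinj⟩ := by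
    ext l
    simp only [GaussDiagram.mem_overpasses, Finset.mem_map, h, Function.Embedding.coeFn_mk,
      List.mem_map]
    constructor
    · rintro ⟨⟨a, ha, rfl⟩, h2, b, hb, hba⟩
      rw [hmate] at hba
      exact ⟨a, ⟨ha, h2, hinj hba ▸ hb⟩, rfl⟩
    · rintro ⟨a, ⟨ha, h2, h3⟩, rfl⟩
      exact ⟨⟨a, ha, rfl⟩, h2, a.mate, h3, rfl⟩
  rw [GaussDiagram.linking, GaussDiagram.linking, hset, Finset.sum_map]
  rfl

/-- The ordered linking numbers are invariant under welded isotopy. -/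
theorem WeldedMove.linking_eq {μ : ℕ} {D D' : GaussDiagram μ} (h : WeldedMove D D')
    {i j : Fin μ} (hij : i ≠ j) : D.linking i j = D'.linking i j := by
  cases h with
  | rotate a u v h h' hj =>
    refine GaussDiagram.linking_congr (fun b l => ?_) i j
    by_cases hb : b = a
    · subst hb
      rw [h, h', List.mem_append, List.mem_append, or_comm]
    · rw [hj b hb]
  | rename σ h => exact GaussDiagram.linking_rename σ h i j
  | r1_over x ε h =>
    exact GaussDiagram.linking_r1 (by simp) x ε (by simp) h hij
  | r1_under x ε h =>
    exact GaussDiagram.linking_r1 (by simp) x ε (by simp [or_comm]) h hij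
  | r2_parallel x y ε h =>
    exact GaussDiagram.linking_r2 (by simp [Fin.forall_fin_two]) x y ε (by simp) (by simp) h i j
  | r2_antiparallel x y ε h =>
    exact GaussDiagram.linking_r2 (by simp [Fin.forall_fin_two]) x y ε (by simp)
      (by simp [or_comm]) h i j
  | r3 x y z α β γ h =>
    refine GaussDiagram.linking_localChange (fun a l => ?_) h i j
    fin_cases a <;> simp [mem_ordered]
  | oc x y α β h =>
    refine GaussDiagram.linking_localChange (fun a l => ?_) h i j
    fin_cases a
    simp [or_comm]

/-- The ordered linking number `λ i j` of a welded link, `i ≠ j`, computed from any diagram. -/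
def WeldedLink.linking {μ : ℕ} (L : WeldedLink μ) (i j : Fin μ) (hij : i ≠ j) : ℤ :=
  Quotient.lift (s := weldedSetoid μ) (fun D => D.linking i j) (fun D D' h => by
    induction (h : Relation.EqvGen WeldedMove D D') with
    | rel _ _ h => exact h.linking_eq hij
    | refl _ => rfl
    | symm _ _ _ ih => exact ih.symm
    | trans _ _ _ _ _ ih ih' => exact ih.trans ih') L

/-!
The sum `λ i j + λ j i` is the sum of the signs of the passages on the `i`-th circle whose mate lies
on the `j`-th circle (`GaussDiagram.linking_add_linking`).  It is invariant under welded moves, and a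
`V(n)`-move changes it by a multiple of `n`, since all mates of the `n` passages on one strand lie
on the other strand (`VMove.mutualSigns_modEq`).

For the converse, the key fact is that `V(n)`-moves can reverse any single arrow of the Gauss diagram
while keeping its sign.  As `n` is odd, a row of `n + 1` alternating half twists consists of `n` half
twists followed by a last crossing, and also of a first crossing, with the levels of the two strands
interchanged, followed by `n` half twists.  So inserting `n` half twists in front of a crossing and
deleting the last `n` half twists of the resulting row reverses the arrow
(`VRelated.flip_of_fill`).  Together with the move OC this lets all adjacent passages commute
(`VRelated.of_swap`), so a diagram is determined by the multiset of its arrows, each recorded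
by its two circles and its sign (`Realizes.vRelated`).

The multisets of arrows, up to exchange inside arbitrary diagrams, form a commutative monoid, the
quotient by `arrowCon`.  In it an arrow equals its reversal, an arrow from a circle to itself is
zero by R1, arrows with the same ends and opposite signs cancel by R2, and `n` times an arrow is
zero by the `V(n)`-move.  Hence a multiset of arrows is determined, for each pair `i < j`, by the
sum modulo `n` of the signs of the arrows between the circles `i` and `j` (`mk_eq_sum_weight`,
`arrowCon_of_modEq`), and this is the given invariant (`mutualSigns_ofArrows`).
-/

/-! ### Gauss words and their total multiset of passages -/

/-- All passages of a family of words, on whatever circle they lie. -/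
def totalPassages {μ : ℕ} (w : Fin μ → List Passage) : Multiset Passage :=
  ∑ i, (w i : Multiset Passage)

/-- A multiset of passages that consists of both passages of each of finitely many crossings. -/
def PairedPassages (M : Multiset Passage) : Prop :=
  (M.map Passage.key).Nodup ∧ ∀ l ∈ M, l.mate ∈ M

theorem mem_totalPassages {μ : ℕ} {w : Fin μ → List Passage} {l : Passage} :
    l ∈ totalPassages w ↔ ∃ i, l ∈ w i := by
  simp [totalPassages, Multiset.mem_sum]

theorem map_totalPassages_eq_flatMap {μ : ℕ} (w : Fin μ → List Passage) :
    (totalPassages w).map Passage.key =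
      (((List.finRange μ).flatMap fun i => (w i).map Passage.key : List (ℕ × Bool)) :
        Multiset (ℕ × Bool)) := by
  rw [← Multiset.coe_bind, totalPassages, ← Multiset.coe_mapAddMonoidHom, map_sum]
  rfl

/-- Whether a family of words is a Gauss diagram depends only on its total multiset of passages. -/
theorem exists_word_eq_iff {μ : ℕ} (w : Fin μ → List Passage) :
    (∃ D : GaussDiagram μ, D.word = w) ↔ PairedPassages (totalPassages w) := by
  have hnd : ((totalPassages w).map Passage.key).Nodup ↔
      (∀ i, ((w i).map Passage.key).Nodup) ∧
        ∀ i j, i ≠ j → ((w i).map Passage.key).Disjoint ((w j).map Passage.key) := by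
    rw [map_totalPassages_eq_flatMap, Multiset.coe_nodup, List.nodup_flatMap]
    refine and_congr (by simp) ⟨fun h i j hij => ?_, fun h => ?_⟩
    · have hs : Std.Symm (Function.onFun List.Disjoint fun i => (w i).map Passage.key) :=
        ⟨fun _ _ hab => List.Disjoint.symm hab⟩
      exact h.forall (List.mem_finRange i) (List.mem_finRange j) hij
    · exact (List.nodup_finRange μ).imp (fun {i j} hij => h i j hij)
  constructor
  · rintro ⟨D, rfl⟩
    refine ⟨hnd.2 ⟨D.nodup, D.disjoint⟩, fun l hl => ?_⟩
    obtain ⟨i, hi⟩ := mem_totalPassages.1 hl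
    exact mem_totalPassages.2 (D.mate_mem i l hi)
  · rintro ⟨h1, h2⟩
    exact ⟨⟨w, (hnd.1 h1).1, (hnd.1 h1).2, fun i l hl =>
      mem_totalPassages.1 (h2 l (mem_totalPassages.2 ⟨i, hl⟩))⟩, rfl⟩

theorem GaussDiagram.paired {μ : ℕ} (D : GaussDiagram μ) :
    PairedPassages (totalPassages D.word) :=
  (exists_word_eq_iff _).1 ⟨D, rfl⟩

theorem GaussDiagram.word_injective {μ : ℕ} {D D' : GaussDiagram μ} (h : D.word = D'.word) :
    D = D' := by
  cases D; cases D'; cases h; rfl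

theorem GaussDiagram.eq_of_key_eq {μ : ℕ} (D : GaussDiagram μ) {i j : Fin μ} {l l' : Passage}
    (h : l ∈ D.word i) (h' : l' ∈ D.word j) (hk : l.key = l'.key) : l = l' := by
  obtain rfl := D.eq_of_key h h' hk
  exact List.inj_on_of_nodup_map (D.nodup i) h h' hk

theorem PairedPassages.add {M N : Multiset Passage} (hM : PairedPassages M)
    (hN : PairedPassages N) (h : ∀ a ∈ M, ∀ b ∈ N, a.1 ≠ b.1) : PairedPassages (M + N) := by
  refine ⟨?_, fun l hl => ?_⟩
  · rw [Multiset.map_add, Multiset.nodup_add]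
    refine ⟨hM.1, hN.1, Multiset.disjoint_left.2 (@fun k hk hk' => ?_)⟩
    obtain ⟨a, ha, rfl⟩ := Multiset.mem_map.1 hk
    obtain ⟨b, hb, hab⟩ := Multiset.mem_map.1 hk'
    exact h a ha b hb (congrArg Prod.fst hab).symm
  · rcases Multiset.mem_add.1 hl with hl | hl
    · exact Multiset.mem_add.2 (Or.inl (hM.2 l hl))
    · exact Multiset.mem_add.2 (Or.inr (hN.2 l hl))

theorem PairedPassages.fst_ne_of_add {M N : Multiset Passage} (h : PairedPassages (M + N))
    (hN : PairedPassages N) {a b : Passage} (ha : a ∈ M) (hb : b ∈ N) : a.1 ≠ b.1 := by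
  intro hab
  have h1 := h.1
  rw [Multiset.map_add, Multiset.nodup_add] at h1
  have h2 := Multiset.disjoint_left.1 h1.2.2 (Multiset.mem_map_of_mem Passage.key ha)
  by_cases hl : a.2.1 = b.2.1
  · exact h2 (Multiset.mem_map.2 ⟨b, hb, by simp [Passage.key, hab, hl]⟩)
  · refine h2 (Multiset.mem_map.2 ⟨b.mate, hN.2 b hb, ?_⟩)
    simp only [Passage.key, Passage.mate, hab, Prod.mk.injEq, true_and]
    cases h3 : a.2.1 <;> cases h4 : b.2.1 <;> simp_all

theorem PairedPassages.of_add_right {M N : Multiset Passage} (h : PairedPassages (M + N))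
    (hN : PairedPassages N) : PairedPassages M := by
  refine ⟨?_, fun l hl => ?_⟩
  · have h1 := h.1
    rw [Multiset.map_add, Multiset.nodup_add] at h1
    exact h1.1
  · rcases Multiset.mem_add.1 (h.2 l (Multiset.mem_add.2 (Or.inl hl))) with h1 | h1
    · exact h1
    · exact (h.fst_ne_of_add hN hl h1 rfl).elim

/-- Both passages of crossings with distinct names `z k`; `b k` is the level of the passage that
is listed in the first summand. -/
theorem pairedPassages_map {α : Type*} (L : List α) (z : α → ℕ) (b : α → Bool) (e : α → ℤˣ)
    (h : (L.map z).Nodup) :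
    PairedPassages ((L.map (fun k => ((z k, b k, e k) : Passage)) : Multiset Passage) +
      (L.map (fun k => ((z k, !b k, e k) : Passage)) : Multiset Passage)) := by
  have key : ∀ c : α → Bool,
      ((L.map (fun k => ((z k, c k, e k) : Passage))).map Passage.key).Nodup := by
    intro c
    refine List.Nodup.of_map Prod.fst ?_
    simpa [Function.comp_def, Passage.key] using h
  refine ⟨?_, fun l hl => ?_⟩
  · rw [Multiset.map_add, Multiset.nodup_add]
    refine ⟨by simpa only [Multiset.map_coe, Multiset.coe_nodup] using key b,
      by simpa only [Multiset.map_coe, Multiset.coe_nodup] using key fun k => !b k,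
      Multiset.disjoint_left.2 (@fun k hk hk' => ?_)⟩
    simp only [Multiset.map_coe, Multiset.mem_coe, List.mem_map, Passage.key] at hk hk'
    obtain ⟨_, ⟨c, hc, rfl⟩, rfl⟩ := hk
    obtain ⟨_, ⟨d, hd, rfl⟩, hcd⟩ := hk'
    simp only [Prod.mk.injEq] at hcd
    obtain rfl := List.inj_on_of_nodup_map h hd hc hcd.1
    cases hb : b d <;> simp [hb] at hcd
  · simp only [Multiset.mem_add, Multiset.mem_coe, List.mem_map] at hl ⊢
    rcases hl with ⟨c, hc, rfl⟩ | ⟨c, hc, rfl⟩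
    · exact Or.inr ⟨c, hc, rfl⟩
    · exact Or.inl ⟨c, hc, by simp [Passage.mate]⟩

theorem exists_forall_fst_lt {μ : ℕ} (D : GaussDiagram μ) :
    ∃ M : ℕ, ∀ i, ∀ l ∈ D.word i, l.1 < M := by
  refine ⟨((totalPassages D.word).map Prod.fst).toFinset.sup id + 1, fun i l hl => ?_⟩
  refine Nat.lt_succ_of_le (Finset.le_sup (f := id) ?_)
  rw [Multiset.mem_toFinset]
  exact Multiset.mem_map_of_mem _ (mem_totalPassages.2 ⟨i, hl⟩)

/-! ### Filling open diagrams -/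

namespace OpenDiagram

theorem totalPassages_fill {μ k : ℕ} {W : OpenDiagram μ k}
    (hW : ∀ h, ∑ i, (W i).countP (fun s => s = Sum.inr h) = 1) (f : Fin k → List Passage) :
    totalPassages (W.fill f) =
      totalPassages (W.fill fun _ => []) + ∑ h, (f h : Multiset Passage) := by
  have key : ∀ w : List (Passage ⊕ Fin k),
      ((w.flatMap (Sum.elim (fun l => [l]) f) : List Passage) : Multiset Passage) =
        (w.flatMap (Sum.elim (fun l => [l]) fun _ => []) : List Passage) +
          ∑ h, w.countP (fun s => s = Sum.inr h) • (f h : Multiset Passage) := by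
    intro w
    induction w with
    | nil => simp
    | cons s w ih =>
      rcases s with l | h
      · simp only [List.flatMap_cons, Sum.elim_inl, ← Multiset.coe_add, ih, List.countP_cons]
        simp [← Multiset.cons_coe]
      · simp only [List.flatMap_cons, Sum.elim_inr, ← Multiset.coe_add, ih, List.countP_cons]
        simp only [Multiset.coe_nil, zero_add, add_smul, Finset.sum_add_distrib,
          Sum.inr.injEq, decide_eq_true_eq, ite_smul, one_smul, zero_smul,
          Finset.sum_ite_eq, Finset.mem_univ, if_true]
        abel
  simp only [totalPassages, fill, key, Finset.sum_add_distrib]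
  rw [Finset.sum_comm]
  congr 1
  refine Finset.sum_congr rfl fun h _ => ?_
  rw [← Finset.sum_smul, hW, one_smul]

/-- If the strands carry passages of complete crossings, these may be exchanged for passages of
other complete crossings whose names do not occur outside the strands. -/
theorem exists_word_eq_fill {μ k : ℕ} {W : OpenDiagram μ k}
    (hW : ∀ h, ∑ i, (W i).countP (fun s => s = Sum.inr h) = 1) {f : Fin k → List Passage}
    (hf : PairedPassages (∑ h, (f h : Multiset Passage)))
    (h0 : PairedPassages (totalPassages (W.fill fun _ => [])))
    (hfresh : ∀ i, ∀ l ∈ W.fill (fun _ => []) i, ∀ h, ∀ l' ∈ f h, l.1 ≠ l'.1) :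
    ∃ D : GaussDiagram μ, D.word = W.fill f := by
  rw [exists_word_eq_iff, totalPassages_fill hW]
  refine h0.add hf fun a ha b hb => ?_
  obtain ⟨i, hi⟩ := mem_totalPassages.1 ha
  obtain ⟨h, -, hb⟩ := Multiset.mem_sum.1 hb
  exact hfresh i a hi h b hb

/-- Shorten the open arcs: the arc `h` is replaced by the passages `p h`, a shorter open arc, and the
passages `q h`. -/
def surround {μ k : ℕ} (W : OpenDiagram μ k) (p q : Fin k → List Passage) : OpenDiagram μ k :=
  fun i => (W i).flatMap (Sum.elim (fun l => [Sum.inl l])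
    (fun h => (p h).map Sum.inl ++ Sum.inr h :: (q h).map Sum.inl))

theorem fill_surround {μ k : ℕ} (W : OpenDiagram μ k) (p q f : Fin k → List Passage) :
    (W.surround p q).fill f = W.fill fun h => p h ++ f h ++ q h := by
  funext i
  simp only [fill, surround, List.flatMap_assoc]
  congr 1
  funext s
  rcases s with l | h <;> simp [List.flatMap_map]

theorem countP_surround {μ k : ℕ} (W : OpenDiagram μ k) (p q : Fin k → List Passage)
    (i : Fin μ) (h : Fin k) : (W.surround p q i).countP (fun s => s = Sum.inr h) =
      (W i).countP (fun s => s = Sum.inr h) := by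
  have hinl : ∀ l : List Passage,
      (l.map (Sum.inl : _ → Passage ⊕ Fin k)).countP (fun s => s = Sum.inr h) = 0 := by
    intro l
    simp [List.countP_eq_zero]
  simp only [surround]
  induction W i with
  | nil => rfl
  | cons s w ih =>
    rw [List.flatMap_cons, List.countP_append, ih, List.countP_cons, add_comm]
    rcases s with l | h'
    · simp
    · simp [List.countP_append, List.countP_cons, hinl]

end OpenDiagram

theorem localChange_of_surround {μ k : ℕ} {W : OpenDiagram μ k}
    (hW : ∀ h, ∑ i, (W i).countP (fun s => s = Sum.inr h) = 1)
    (p q : Fin k → List Passage) {f f' : Fin k → List Passage} {D D' : GaussDiagram μ}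
    (hD : D.word = W.fill fun h => p h ++ f h ++ q h)
    (hD' : D'.word = W.fill fun h => p h ++ f' h ++ q h) : LocalChange f f' D D' :=
  ⟨W.surround p q, by simpa only [OpenDiagram.countP_surround] using hW,
    by rw [hD, OpenDiagram.fill_surround], by rw [hD', OpenDiagram.fill_surround]⟩

theorem LocalChange.swap {μ : ℕ} {a b a' b' : List Passage} {D D' : GaussDiagram μ}
    (h : LocalChange ![a, b] ![a', b'] D D') : LocalChange ![b, a] ![b', a'] D D' := by
  obtain ⟨W, hW, hD, hD'⟩ := h
  have hfill : ∀ c d : List Passage,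
      OpenDiagram.fill (fun i => (W i).map (Sum.map id (Equiv.swap (0 : Fin 2) 1))) ![d, c] =
        W.fill ![c, d] := by
    intro c d
    funext i
    simp only [OpenDiagram.fill, List.flatMap_map]
    congr 1
    funext s
    rcases s with l | h
    · rfl
    · fin_cases h <;> rfl
  refine ⟨fun i => (W i).map (Sum.map id (Equiv.swap (0 : Fin 2) 1)), fun h => ?_, ?_, ?_⟩
  · refine Eq.trans ?_ (hW (Equiv.swap 0 1 h))
    refine Finset.sum_congr rfl fun i _ => ?_
    rw [List.countP_map]
    refine List.countP_congr fun s _ => ?_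
    rcases s with l | h'
    · simp
    · simp [Equiv.swap_apply_eq_iff]
  · rw [hD, hfill]
  · rw [hD', hfill]

/-! ### Reversing an arrow -/

/-- The relation between diagrams that is generated by welded moves and `V(n)`-moves. -/
def VRelated {μ : ℕ} (n : ℕ) : GaussDiagram μ → GaussDiagram μ → Prop :=
  Relation.EqvGen fun E E' => WeldedMove E E' ∨ VMove n E E'

namespace VRelated

variable {μ n : ℕ} {D D' D'' : GaussDiagram μ}

theorem refl (D : GaussDiagram μ) : VRelated n D D := Relation.EqvGen.refl _

theorem symm (h : VRelated n D D') : VRelated n D' D := Relation.EqvGen.symm _ _ h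

theorem trans (h : VRelated n D D') (h' : VRelated n D' D'') : VRelated n D D'' :=
  Relation.EqvGen.trans _ _ _ h h'

theorem of_welded (h : WeldedMove D D') : VRelated n D D' := Relation.EqvGen.rel _ _ (Or.inl h)

theorem of_vMove (h : VMove n D D') : VRelated n D D' := Relation.EqvGen.rel _ _ (Or.inr h)

theorem of_word_eq (h : D.word = D'.word) : VRelated n D D' :=
  GaussDiagram.word_injective h ▸ refl D

end VRelated

/-- One strand of a row of half twists with crossings `x 0, …, x (m - 1)`; the strand starts as the
overpass if `b` is `true`. -/
def twistStrand (m : ℕ) (x : ℕ → ℕ) (b : Bool) (ε : ℤˣ) : List Passage :=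
  (List.range m).map fun k => (x k, b ^^ decide (Odd k), ε)

theorem twistStrand_succ_left (m : ℕ) (x : ℕ → ℕ) (b : Bool) (ε : ℤˣ) :
    twistStrand (m + 1) x b ε = (x 0, b, ε) :: twistStrand m (fun k => x (k + 1)) (!b) ε := by
  simp only [twistStrand, List.range_succ_eq_map, List.map_cons, List.map_map]
  refine congrArg₂ _ (by simp) (List.map_congr_left fun k _ => ?_)
  by_cases hk : Odd k <;> simp [Nat.odd_add_one, hk]

theorem twistStrand_succ_right {m : ℕ} (hm : Odd m) (x : ℕ → ℕ) (b : Bool) (ε : ℤˣ) :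
    twistStrand (m + 1) x b ε = twistStrand m x b ε ++ [(x m, !b, ε)] := by
  simp [twistStrand, List.range_succ, hm]

theorem paired_twistStrand {m : ℕ} {x : ℕ → ℕ} (hx : Set.InjOn x (Set.Iio m)) (b : Bool)
    (ε : ℤˣ) : PairedPassages ((twistStrand m x b ε : Multiset Passage) +
      (twistStrand m x (!b) ε : Multiset Passage)) := by
  have h := pairedPassages_map (List.range m) x (fun k => b ^^ decide (Odd k)) (fun _ => ε)
    (List.nodup_range.map_on fun a ha c hc hac =>
      hx (List.mem_range.1 ha) (List.mem_range.1 hc) hac)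
  simpa [twistStrand] using h

/-- The two strands of a `V(n)`-move may be named in either order. -/
theorem vMove_of_localChange {μ n : ℕ} {D D' : GaussDiagram μ} (x : ℕ → ℕ) (b : Bool) (ε : ℤˣ)
    (h : LocalChange ![[], []] ![twistStrand n x b ε, twistStrand n x (!b) ε] D D') :
    VMove n D D' := by
  have h1 : twistStrand n x true ε = (List.range n).map
      (fun k => if Even k then Passage.ov (x k) ε else Passage.un (x k) ε) := by
    refine List.map_congr_left fun k _ => ?_
    by_cases hk : Even k <;> simp [hk, Passage.ov, Passage.un, ← Nat.not_even_iff_odd]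
  have h2 : twistStrand n x false ε = (List.range n).map
      (fun k => if Even k then Passage.un (x k) ε else Passage.ov (x k) ε) := by
    refine List.map_congr_left fun k _ => ?_
    by_cases hk : Even k <;> simp [hk, Passage.ov, Passage.un, ← Nat.not_even_iff_odd]
  refine ⟨x, ε, ?_⟩
  rw [← h1, ← h2]
  cases b
  · exact h.swap
  · exact h

/-- Interchange the two passages of the crossings whose names lie in `S`; the signs are kept. -/
def Passage.flip (S : Finset ℕ) (l : Passage) : Passage := if l.1 ∈ S then l.mate else l

theorem Passage.flip_fst (S : Finset ℕ) (l : Passage) : (l.flip S).1 = l.1 := by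
  unfold Passage.flip; split_ifs <;> rfl

theorem Passage.flip_mate (S : Finset ℕ) (l : Passage) : (l.flip S).mate = l.mate.flip S := by
  have h : l.mate.1 = l.1 := rfl
  unfold Passage.flip
  rw [h]
  split_ifs <;> rfl

theorem Passage.flip_key_inj {S : Finset ℕ} {l l' : Passage}
    (h : (l.flip S).key = (l'.flip S).key) : l.key = l'.key := by
  have h1 : l.1 = l'.1 := by
    have := congrArg Prod.fst h
    simpa [Passage.key, Passage.flip_fst] using this
  have h2 := congrArg Prod.snd h
  unfold Passage.flip at h2
  rw [h1] at h2
  split_ifs at h2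
  · simpa [Passage.key, h1, Passage.mate] using h2
  · simpa [Passage.key, h1] using h2

/-- Reverse the arrows of the Gauss diagram whose names lie in `S`, with their signs kept. -/
def GaussDiagram.flip {μ : ℕ} (D : GaussDiagram μ) (S : Finset ℕ) : GaussDiagram μ where
  word i := (D.word i).map (Passage.flip S)
  nodup i := by
    rw [List.map_map]
    have h := D.nodup i
    refine List.Nodup.map_on (fun a ha b hb hab => ?_) h.of_map
    exact List.inj_on_of_nodup_map h ha hb (Passage.flip_key_inj hab)
  disjoint i j hij := by
    intro k hk hk'
    simp only [List.map_map, List.mem_map] at hk hk'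
    obtain ⟨a, ha, rfl⟩ := hk
    obtain ⟨b, hb, hab⟩ := hk'
    exact hij (D.eq_of_key ha hb (Passage.flip_key_inj hab).symm)
  mate_mem i l hl := by
    obtain ⟨a, ha, rfl⟩ := List.mem_map.1 hl
    obtain ⟨j, hj⟩ := D.mate_mem i a ha
    exact ⟨j, by rw [Passage.flip_mate]; exact List.mem_map_of_mem hj⟩

theorem GaussDiagram.eq_or_eq_mate {μ : ℕ} (D : GaussDiagram μ) {i j : Fin μ} {l l' : Passage}
    (h : l ∈ D.word i) (h' : l' ∈ D.word j) (hn : l.1 = l'.1) : l = l' ∨ l = l'.mate := by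
  by_cases hb : l.2.1 = l'.2.1
  · exact Or.inl (D.eq_of_key_eq h h' (by simp [Passage.key, hn, hb]))
  · obtain ⟨k, hk⟩ := D.mate_mem j l' h'
    refine Or.inr (D.eq_of_key_eq h hk ?_)
    simp only [Passage.key, Passage.mate, hn, Prod.mk.injEq, true_and]
    cases h3 : l.2.1 <;> cases h4 : l'.2.1 <;> simp_all

theorem GaussDiagram.sum_count_eq_one {μ : ℕ} (D : GaussDiagram μ) {i : Fin μ} {l : Passage}
    (h : l ∈ D.word i) : ∑ j, (D.word j).count l = 1 := by
  rw [Finset.sum_eq_single i]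
  · exact List.count_eq_one_of_mem (D.nodup i).of_map h
  · intro j _ hji
    refine List.count_eq_zero_of_not_mem fun hj => hji ?_
    exact D.eq_of_key hj h rfl
  · simp

/-- A row of `n + 1` half twists whose last crossing is `x` contains `n` half twists in two ways:
inserting the first `n` and deleting the last `n` of them replaces the crossing `x` by a crossing
of the same sign at which the other strand passes over. -/
theorem VRelated.flip_of_fill {μ n : ℕ} (hn : Odd n) {D D' : GaussDiagram μ}
    {W : OpenDiagram μ 2} (hW : ∀ h, ∑ i, (W i).countP (fun s => s = Sum.inr h) = 1)
    (x : ℕ) (ε : ℤˣ) (hD : D.word = W.fill ![[(x, false, ε)], [(x, true, ε)]])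
    (hD' : D'.word = W.fill ![[(x, true, ε)], [(x, false, ε)]]) : VRelated n D D' := by
  obtain ⟨M, hM⟩ := exists_forall_fst_lt D
  have hxM : x < M := by
    obtain ⟨i, hi⟩ := OpenDiagram.exists_mem hW 0
    exact hM i (x, false, ε) (by rw [hD, OpenDiagram.mem_fill]; exact Or.inr ⟨0, hi, by simp⟩)
  have hbase : ∀ i, ∀ l ∈ W.fill (fun _ => []) i, l.1 < M ∧ l.1 ≠ x := by
    intro i l hl
    rw [OpenDiagram.mem_fill] at hl
    have hl : Sum.inl l ∈ W i := by simpa using hl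
    refine ⟨hM i l (by rw [hD, OpenDiagram.mem_fill]; exact Or.inl hl), fun hlx => ?_⟩
    obtain ⟨i0, hi0⟩ := OpenDiagram.exists_mem hW 0
    obtain ⟨i1, hi1⟩ := OpenDiagram.exists_mem hW 1
    have h0 := OpenDiagram.fresh hD hl hi0 (l' := (x, false, ε)) (by simp)
    have h1 := OpenDiagram.fresh hD hl hi1 (l' := (x, true, ε)) (by simp)
    simp only [Passage.key, hlx, ne_eq, Prod.mk.injEq, true_and] at h0 h1
    cases h2 : l.2.1 <;> simp_all
  have hcr : ∀ (y : ℕ) (b : Bool), PairedPassages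
      (([(y, b, ε)] : List Passage) + ([(y, !b, ε)] : List Passage) : Multiset Passage) :=
    fun y b => pairedPassages_map [()] (fun _ => y) (fun _ => b) (fun _ => ε) (by simp)
  have hpair0 : PairedPassages (totalPassages (W.fill fun _ => [])) := by
    have h := D.paired
    rw [hD, OpenDiagram.totalPassages_fill hW] at h
    refine h.of_add_right ?_
    simpa using hcr x false
  -- Fresh names for the first `n` crossings of the row, and the name `x` for the last one.
  set z : ℕ → ℕ := fun k => if k = n then x else M + k with hz
  have hzn : z n = x := by simp [hz]
  have hz0 : z 0 = M := by
    have : 0 ≠ n := fun h => by simp [← h] at hn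
    simp [hz, this]
  have hzinj : Function.Injective z := by
    intro a b hab
    simp only [hz] at hab
    split_ifs at hab <;> omega
  have hzfresh : ∀ i, ∀ l ∈ W.fill (fun _ => []) i, ∀ k, l.1 ≠ z k := by
    intro i l hl k
    have := hbase i l hl
    simp only [hz]
    split_ifs
    · exact this.2
    · omega
  obtain ⟨D₁, hD₁⟩ := OpenDiagram.exists_word_eq_fill hW
    (f := ![twistStrand (n + 1) z true ε, twistStrand (n + 1) z false ε])
    (by simpa using paired_twistStrand (m := n + 1) hzinj.injOn true ε) hpair0 (by
      intro i l hl h l' hl'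
      have : ∃ k, l'.1 = z k := by
        fin_cases h <;> simp only [twistStrand, Fin.zero_eta, Fin.mk_one, Matrix.cons_val_zero,
          Matrix.cons_val_one, List.mem_map] at hl' <;>
          obtain ⟨k, -, rfl⟩ := hl' <;> exact ⟨k, rfl⟩
      obtain ⟨k, hk⟩ := this
      rw [hk]
      exact hzfresh i l hl k)
  obtain ⟨D₂, hD₂⟩ := OpenDiagram.exists_word_eq_fill hW
    (f := ![[(z 0, true, ε)], [(z 0, false, ε)]])
    (by simpa using hcr (z 0) true) hpair0 (by
      intro i l hl h l' hl'
      have : l'.1 = z 0 := by fin_cases h <;> simp at hl' <;> simp [hl']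
      rw [this]
      exact hzfresh i l hl 0)
  -- The row arises from the crossing `x` by inserting its first `n` crossings,
  have h01 : VRelated n D D₁ := by
    refine .of_vMove (vMove_of_localChange z true ε (localChange_of_surround hW (fun _ => [])
      ![[(x, false, ε)], [(x, true, ε)]] ?_ ?_))
    · rw [hD]
      congr 1
      funext h
      fin_cases h <;> rfl
    · rw [hD₁]
      congr 1
      funext h
      fin_cases h <;> simp [twistStrand_succ_right hn, hzn]
  -- and from its first crossing `z 0`, at which the other strand passes over, by inserting the rest.
  have h21 : VRelated n D₂ D₁ := by
    refine .of_vMove (vMove_of_localChange (fun k => z (k + 1)) false ε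
      (localChange_of_surround hW ![[(z 0, true, ε)], [(z 0, false, ε)]] (fun _ => []) ?_ ?_))
    · rw [hD₂]
      congr 1
      funext h
      fin_cases h <;> rfl
    · rw [hD₁]
      congr 1
      funext h
      fin_cases h <;> simp [twistStrand_succ_left]
  have h23 : VRelated n D₂ D' := by
    refine .of_welded (.rename (Equiv.swap (z 0) x) fun i => ?_)
    rw [hD', hD₂, OpenDiagram.fill, OpenDiagram.fill, List.map_flatMap]
    refine List.flatMap_congr fun s hs => ?_
    rcases s with l | h
    · have hl : l ∈ W.fill (fun _ => []) i := by rw [OpenDiagram.mem_fill]; exact Or.inl hs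
      simp [Passage.rename, Equiv.swap_apply_of_ne_of_ne (hzfresh i l hl 0) (hbase i l hl).2]
    · fin_cases h <;> simp [Passage.rename]
  exact (h01.trans h21.symm).trans h23

theorem VRelated.flip_singleton {μ n : ℕ} (hn : Odd n) (D : GaussDiagram μ) (x : ℕ) :
    VRelated n D (D.flip {x}) := by
  by_cases hx : ∃ i, ∃ l ∈ D.word i, l.1 = x
  · obtain ⟨ε, i, j, hu, ho⟩ : ∃ (ε : ℤˣ) (i j : Fin μ),
        ((x, false, ε) : Passage) ∈ D.word i ∧ ((x, true, ε) : Passage) ∈ D.word j := by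
      obtain ⟨i, ⟨y, b, ε⟩, hl, rfl⟩ := hx
      obtain ⟨j, hj⟩ := D.mate_mem i _ hl
      cases b
      · exact ⟨ε, i, j, hl, hj⟩
      · exact ⟨ε, j, i, hj, hl⟩
    let g : Passage → Passage ⊕ Fin 2 := fun l =>
      if l = (x, false, ε) then Sum.inr 0 else if l = (x, true, ε) then Sum.inr 1 else Sum.inl l
    refine VRelated.flip_of_fill hn (W := fun i => (D.word i).map g) ?_ x ε ?_ ?_
    · intro h
      have key : ∀ l : Passage, g l = Sum.inr h ↔ l = (x, decide (h = 1), ε) := by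
        intro l
        simp only [g]
        fin_cases h
        · by_cases h1 : l = (x, false, ε)
          · simp [h1]
          · by_cases h2 : l = (x, true, ε) <;> simp [h1, h2]
        · by_cases h1 : l = (x, false, ε)
          · simp [h1]
          · by_cases h2 : l = (x, true, ε) <;> simp [h1, h2]
      have hm : ∃ i, ((x, decide (h = 1), ε) : Passage) ∈ D.word i := by
        fin_cases h
        · exact ⟨i, hu⟩
        · exact ⟨j, ho⟩
      obtain ⟨i', hi'⟩ := hm
      rw [← D.sum_count_eq_one hi']
      refine Finset.sum_congr rfl fun a _ => ?_
      rw [List.countP_map, List.count]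
      refine List.countP_congr fun l _ => ?_
      simp [key]
    · funext i
      simp only [OpenDiagram.fill, List.flatMap_map]
      conv_lhs => rw [← List.flatMap_singleton' (D.word i)]
      refine List.flatMap_congr fun l _ => ?_
      simp only [g]
      split_ifs with h1 h2
      · simp [h1]
      · simp [h2]
      · simp
    · funext i
      simp only [OpenDiagram.fill, List.flatMap_map, GaussDiagram.flip]
      rw [List.map_eq_flatMap]
      refine List.flatMap_congr fun l hl => ?_
      simp only [g]
      split_ifs with h1 h2
      · simp [h1, Passage.flip, Passage.mate]
      · simp [h2, Passage.flip, Passage.mate]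
      · have : l.1 ≠ x := fun h => by
          rcases D.eq_or_eq_mate hl hu h with h | h
          · exact h1 h
          · exact h2 h
        simp [Passage.flip, this]
  · push Not at hx
    refine .of_word_eq (funext fun i => ?_)
    simp only [GaussDiagram.flip]
    conv_lhs => rw [← List.map_id (D.word i)]
    refine List.map_congr_left fun l hl => ?_
    simp [Passage.flip, hx i l hl]

/-- Every arrow can be reversed. -/
theorem VRelated.flip {μ n : ℕ} (hn : Odd n) (D : GaussDiagram μ) (S : Finset ℕ) :
    VRelated n D (D.flip S) := by
  induction S using Finset.induction_on with
  | empty =>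
    refine .of_word_eq (funext fun i => ?_)
    have : Passage.flip ∅ = id := by funext l; simp [Passage.flip]
    simp [GaussDiagram.flip, this]
  | insert x S hx ih =>
    refine (ih.trans (.flip_singleton hn _ x)).trans (.of_word_eq (funext fun i => ?_))
    simp only [GaussDiagram.flip, List.map_map]
    refine List.map_congr_left fun l _ => ?_
    rw [Function.comp_apply]
    by_cases h1 : l.1 = x
    · simp [Passage.flip, h1, hx]
    · by_cases h2 : l.1 ∈ S
      · have h3 : l.mate.1 = l.1 := rfl
        simp [Passage.flip, h1, h2, h3]
      · simp [Passage.flip, h1, h2]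

/-! ### All passages commute -/

theorem GaussDiagram.exists_word_eq_of_perm {μ : ℕ} (D : GaussDiagram μ)
    {w : Fin μ → List Passage} (h : ∀ i, (D.word i).Perm (w i)) :
    ∃ D' : GaussDiagram μ, D'.word = w := by
  rw [exists_word_eq_iff]
  have : totalPassages w = totalPassages D.word :=
    Finset.sum_congr rfl fun i _ => (Multiset.coe_eq_coe.2 (h i)).symm
  rw [this]
  exact D.paired

theorem weldedMove_oc_of_update {μ : ℕ} {D D' : GaussDiagram μ} {i : Fin μ} {a b : Passage}
    {u v : List Passage} (ha : a.2.1 = true) (hb : b.2.1 = true)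
    (h : D.word i = u ++ a :: b :: v) (h' : D'.word = Function.update D.word i (u ++ b :: a :: v)) :
    WeldedMove D D' := by
  obtain ⟨x, _, α⟩ := a
  obtain ⟨y, _, β⟩ := b
  obtain rfl := ha
  obtain rfl := hb
  have hinl : ∀ l : List Passage, (l.map (Sum.inl : _ → Passage ⊕ Fin 1)).countP
      (fun s => s = Sum.inr 0) = 0 := by
    intro l
    simp [List.countP_eq_zero]
  refine .oc x y α β ⟨Function.update (fun j => (D.word j).map Sum.inl) i
    (u.map Sum.inl ++ Sum.inr 0 :: v.map Sum.inl), fun c => ?_, ?_, ?_⟩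
  · obtain rfl : c = 0 := Subsingleton.elim _ _
    rw [Finset.sum_eq_single i]
    · simp [hinl]
    · intro j _ hj
      rw [Function.update_of_ne hj, hinl]
    · simp
  · funext j
    by_cases hj : j = i
    · subst hj
      simp [OpenDiagram.fill, h, List.flatMap_map, Passage.ov]
    · simp [OpenDiagram.fill, hj, List.flatMap_map]
  · funext j
    rw [h']
    by_cases hj : j = i
    · subst hj
      simp [OpenDiagram.fill, List.flatMap_map, Passage.ov]
    · simp [OpenDiagram.fill, hj, List.flatMap_map]

/-- Consecutive overpasses commute by the move OC.  Other consecutive passages through different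
crossings become overpasses by reversing arrows, and the two passages through the same crossing are
interchanged by reversing its arrow. -/
theorem VRelated.of_swap {μ n : ℕ} (hn : Odd n) {D D' : GaussDiagram μ} {i : Fin μ}
    {a b : Passage} {u v : List Passage} (h : D.word i = u ++ a :: b :: v)
    (h' : D'.word = Function.update D.word i (u ++ b :: a :: v)) : VRelated n D D' := by
  have ha : a ∈ D.word i := by simp [h]
  have hb : b ∈ D.word i := by simp [h]
  have hnd : (u ++ a :: b :: v).Nodup := h ▸ (D.nodup i).of_map
  by_cases hab : a.1 = b.1
  · have hne : a ≠ b := by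
      rintro rfl
      simp [List.nodup_append] at hnd
    have hmate : a = b.mate := (D.eq_or_eq_mate ha hb hab).resolve_left hne
    have hother : ∀ j, ∀ l ∈ D.word j, l ≠ a → l ≠ b → l.flip {a.1} = l := by
      intro j l hl hla hlb
      have : l.1 ≠ a.1 := fun hl1 => by
        rcases D.eq_or_eq_mate hl ha hl1 with h1 | h1
        · exact hla h1
        · rw [hmate, Passage.mate_mate] at h1
          exact hlb h1
      simp [Passage.flip, this]
    refine (VRelated.flip hn D {a.1}).trans (.of_word_eq (funext fun j => ?_))
    rw [h']
    by_cases hj : j = i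
    · subst hj
      have hu : ∀ l ∈ u, l.flip {a.1} = l := fun l hl =>
        hother j l (by simp [h, hl]) ((List.nodup_append.1 hnd).2.2 l hl a (by simp))
          ((List.nodup_append.1 hnd).2.2 l hl b (by simp))
      have hv : ∀ l ∈ v, l.flip {a.1} = l := fun l hl => by
        have hnd' := (List.nodup_append.1 hnd).2.1
        rw [List.nodup_cons, List.nodup_cons, List.mem_cons, not_or] at hnd'
        exact hother j l (by simp [h, hl]) (ne_of_mem_of_not_mem hl hnd'.1.2)
          (ne_of_mem_of_not_mem hl hnd'.2.1)
      have e1 : a.flip {a.1} = b := by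
        simp only [Passage.flip, Finset.mem_singleton, if_true]
        rw [hmate, Passage.mate_mate]
      have e2 : b.flip {a.1} = a := by
        simp only [Passage.flip, Finset.mem_singleton, hab, if_true]
        exact hmate.symm
      simp only [GaussDiagram.flip, h, List.map_append, List.map_cons, e1, e2,
        Function.update_self]
      rw [List.map_congr_left hu, List.map_congr_left hv]
      simp
    · rw [Function.update_of_ne hj]
      simp only [GaussDiagram.flip]
      conv_rhs => rw [← List.map_id (D.word j)]
      refine List.map_congr_left fun l hl => hother j l hl ?_ ?_
      · rintro rfl
        exact hj (D.eq_of_key hl ha rfl)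
      · rintro rfl
        exact hj (D.eq_of_key hl hb rfl)
  · -- The names of those of the two passages that are underpasses.
    let S : Finset ℕ := (if a.2.1 then ∅ else {a.1}) ∪ (if b.2.1 then ∅ else {b.1})
    have hS : ∀ l : Passage, (l = a ∨ l = b) → (l.flip S).2.1 = true := by
      rintro l (rfl | rfl)
      · cases h1 : l.2.1 <;> cases h2 : b.2.1 <;>
          simp [S, Passage.flip, Passage.mate, h1, h2, hab]
      · have hab' : l.1 ≠ a.1 := fun h => hab h.symm
        cases h1 : a.2.1 <;> cases h2 : l.2.1 <;>
          simp [S, Passage.flip, Passage.mate, h1, h2, hab']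
    have hD'S : (D'.flip S).word = Function.update (D.flip S).word i
        (u.map (Passage.flip S) ++ b.flip S :: a.flip S :: v.map (Passage.flip S)) := by
      funext j
      by_cases hj : j = i
      · subst hj
        simp [GaussDiagram.flip, h']
      · simp [GaussDiagram.flip, h', hj]
    have hDS : (D.flip S).word i =
        u.map (Passage.flip S) ++ a.flip S :: b.flip S :: v.map (Passage.flip S) := by
      simp [GaussDiagram.flip, h]
    exact ((VRelated.flip hn D S).trans (.of_welded (weldedMove_oc_of_update (hS a (Or.inl rfl))
      (hS b (Or.inr rfl)) hDS hD'S))).trans (VRelated.flip hn D' S).symm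

theorem VRelated.of_perm_update {μ n : ℕ} (hn : Odd n) {i : Fin μ} {v v' : List Passage}
    (hv : v.Perm v') : ∀ (u : List Passage) (D D' : GaussDiagram μ), D.word i = u ++ v →
      D'.word = Function.update D.word i (u ++ v') → VRelated n D D' := by
  induction hv with
  | nil =>
    intro u D D' h h'
    exact .of_word_eq (by rw [h', ← h, Function.update_eq_self])
  | cons x _ ih =>
    intro u D D' h h'
    exact ih (u ++ [x]) D D' (by simpa using h) (by simpa using h')
  | swap x y l =>
    intro u D D' h h'
    exact .of_swap hn h h'
  | trans h1 _ ih1 ih2 =>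
    rename_i l₁ l₂ l₃ _
    intro u D D' h h'
    obtain ⟨E, hE⟩ := D.exists_word_eq_of_perm (w := Function.update D.word i (u ++ l₂)) (by
      intro j
      by_cases hj : j = i
      · subst hj
        rw [h, Function.update_self]
        exact h1.append_left u
      · rw [Function.update_of_ne hj])
    refine (ih1 u D E h hE).trans (ih2 u E D' (by simp [hE]) ?_)
    rw [hE, Function.update_idem, h']

/-- The order of the passages on the circles does not matter. -/
theorem VRelated.of_perm {μ n : ℕ} (hn : Odd n) {D D' : GaussDiagram μ}
    (h : ∀ i, (D.word i).Perm (D'.word i)) : VRelated n D D' := by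
  suffices H : ∀ (S : Finset (Fin μ)) (E : GaussDiagram μ),
      (E.word = fun i => if i ∈ S then D'.word i else D.word i) → VRelated n D E by
    exact H Finset.univ D' (by simp)
  intro S
  induction S using Finset.induction_on with
  | empty => exact fun E hE => .of_word_eq (by simp [hE])
  | insert a S ha ih =>
    intro E hE
    obtain ⟨F, hF⟩ := D.exists_word_eq_of_perm (w := fun i => if i ∈ S then D'.word i else D.word i)
      (by intro i; split_ifs <;> simp [h])
    refine (ih F hF).trans (.of_perm_update hn (i := a) (h a) [] F E (by simp [hF, ha]) ?_)
    funext j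
    by_cases hj : j = a
    · subst hj
      simp [hE]
    · simp [hE, hF, hj]

/-! ### Invariance of the linking numbers modulo `n` -/

/-- The sum of the signs of the passages on the `i`-th circle whose mate lies on the `j`-th
circle. -/
def GaussDiagram.mutualSigns {μ : ℕ} (D : GaussDiagram μ) (i j : Fin μ) : ℤ :=
  ((D.word i).map fun l => if l.mate ∈ D.word j then (l.sign : ℤ) else 0).sum

theorem GaussDiagram.linking_add_linking {μ : ℕ} (D : GaussDiagram μ) (i j : Fin μ) :
    D.linking i j + D.linking j i = D.mutualSigns i j := by
  rw [mutualSigns, ← List.sum_toFinset _ (D.nodup i).of_map, ← Finset.sum_filter,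
    ← Finset.sum_filter_add_sum_filter_not _ (fun l : Passage => l.isOver = true)]
  congr 1
  · rw [linking, overpasses, Finset.filter_filter]
    simp only [and_comm]
  · rw [linking]
    refine Finset.sum_nbij' Passage.mate Passage.mate ?_ ?_ ?_ ?_ ?_
    · intro l hl
      rw [mem_overpasses] at hl
      simp only [Finset.mem_filter, List.mem_toFinset, Passage.mate_mate]
      exact ⟨⟨hl.2.2, hl.1⟩, by have := hl.2.1; simp_all [Passage.isOver, Passage.mate]⟩
    · intro l hl
      simp only [Finset.mem_filter, List.mem_toFinset] at hl
      rw [mem_overpasses, Passage.mate_mate]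
      exact ⟨hl.1.2, by have := hl.2; simp_all [Passage.isOver, Passage.mate], hl.1.1⟩
    · intro l _
      exact l.mate_mate
    · intro l _
      exact l.mate_mate
    · intro l _
      rfl

/-- All mates of the passages on one strand of a `V(n)`-move lie on the other strand, so a strand
contributes either `0` or `n` times the sign of its crossings. -/
theorem VMove.mutualSigns_modEq {μ n : ℕ} {D D' : GaussDiagram μ} (h : VMove n D D')
    (i j : Fin μ) : D.mutualSigns i j ≡ D'.mutualSigns i j [ZMOD n] := by
  obtain ⟨x, ε, W, hW, hD, hD'⟩ := h
  set f : Fin 2 → List Passage :=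
    ![(List.range n).map (fun k => if Even k then Passage.ov (x k) ε else Passage.un (x k) ε),
      (List.range n).map (fun k => if Even k then Passage.un (x k) ε else Passage.ov (x k) ε)]
    with hf
  have hlen : ∀ h, (f h).length = n := by
    intro h; fin_cases h <;> simp [hf]
  have hsign : ∀ h, ∀ l ∈ f h, l.sign = ε := by
    intro h l hl
    fin_cases h <;> simp only [hf, Fin.zero_eta, Fin.mk_one, Matrix.cons_val_zero,
      Matrix.cons_val_one, List.mem_map] at hl <;> obtain ⟨k, -, rfl⟩ := hl <;>
      split_ifs <;> rfl
  have hmate : ∀ h, ∃ h', ∀ l ∈ f h, l.mate ∈ f h' := by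
    intro h
    fin_cases h
    · refine ⟨1, fun l hl => ?_⟩
      simp only [hf, Fin.zero_eta, Matrix.cons_val_zero, Matrix.cons_val_one,
        List.mem_map] at hl ⊢
      obtain ⟨k, hk, rfl⟩ := hl
      exact ⟨k, hk, by split_ifs <;> rfl⟩
    · refine ⟨0, fun l hl => ?_⟩
      simp only [hf, Fin.mk_one, Matrix.cons_val_zero, Matrix.cons_val_one,
        List.mem_map] at hl ⊢
      obtain ⟨k, hk, rfl⟩ := hl
      exact ⟨k, hk, by split_ifs <;> rfl⟩
  -- Passages outside the strands keep their contributions,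
  have hold : ∀ l, Sum.inl l ∈ W i → (l.mate ∈ D'.word j ↔ l.mate ∈ D.word j) := by
    intro l hl
    rw [hD, hD', OpenDiagram.mem_fill, OpenDiagram.mem_fill]
    have : ¬ ∃ h, Sum.inr h ∈ W j ∧ l.mate ∈ f h := by
      rintro ⟨h, -, hlh⟩
      obtain ⟨h', hh'⟩ := hmate h
      obtain ⟨a, ha⟩ := OpenDiagram.exists_mem hW h'
      have := hh' _ hlh
      rw [Passage.mate_mate] at this
      exact OpenDiagram.fresh hD' hl ha this rfl
    refine or_congr_right (iff_of_false this ?_)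
    rintro ⟨h, -, hlh⟩
    fin_cases h <;> simp at hlh
  -- and each strand contributes a multiple of `n`.
  have hnew : ∀ h, (((f h).map fun l => if l.mate ∈ D'.word j then (l.sign : ℤ) else 0).sum) ≡ 0
      [ZMOD n] := by
    intro h
    obtain ⟨h', hh'⟩ := hmate h
    obtain ⟨a, ha⟩ := OpenDiagram.exists_mem hW h'
    have ha' : ∀ l ∈ f h, l.mate ∈ D'.word a := fun l hl => by
      rw [hD', OpenDiagram.mem_fill]
      exact Or.inr ⟨h', ha, hh' l hl⟩
    have hconst : ∀ l ∈ f h, (if l.mate ∈ D'.word j then (l.sign : ℤ) else 0) =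
        if j = a then (ε : ℤ) else 0 := by
      intro l hl
      rw [hsign h l hl]
      refine if_congr ⟨fun hj => D'.eq_of_key hj (ha' l hl) rfl, ?_⟩ rfl rfl
      rintro rfl
      exact ha' l hl
    rw [List.map_congr_left hconst, List.map_const', List.sum_replicate, hlen]
    refine (Int.modEq_zero_iff_dvd).2 ?_
    rw [nsmul_eq_mul]
    exact dvd_mul_right _ _
  have hsum : ∀ w : List (Passage ⊕ Fin 2), (∀ s ∈ w, s ∈ W i) →
      ((w.flatMap (Sum.elim (fun l => [l]) ![[], []])).map
        fun l => if l.mate ∈ D.word j then (l.sign : ℤ) else 0).sum ≡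
      ((w.flatMap (Sum.elim (fun l => [l]) f)).map
        fun l => if l.mate ∈ D'.word j then (l.sign : ℤ) else 0).sum [ZMOD n] := by
    intro w
    induction w with
    | nil => intro _; rfl
    | cons s w ih =>
      intro hw
      simp only [List.flatMap_cons, List.map_append, List.sum_append]
      refine Int.ModEq.add ?_ (ih fun s hs => hw s (List.mem_cons_of_mem _ hs))
      rcases s with l | h
      · have := hold l (hw _ List.mem_cons_self)
        simp only [Sum.elim_inl, List.map_cons, List.map_nil, this]
        rfl
      · refine Int.ModEq.trans ?_ (hnew h).symm
        fin_cases h <;> simp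
  rw [GaussDiagram.mutualSigns, GaussDiagram.mutualSigns]
  have := hsum (W i) fun _ hs => hs
  have e1 : D.word i = (W i).flatMap (Sum.elim (fun l => [l]) ![[], []]) := congrFun hD i
  have e2 : D'.word i = (W i).flatMap (Sum.elim (fun l => [l]) f) := congrFun hD' i
  rw [← e1, ← e2] at this
  exact this

theorem VRelated.mutualSigns_modEq {μ n : ℕ} {D D' : GaussDiagram μ} (h : VRelated n D D')
    {i j : Fin μ} (hij : i ≠ j) : D.mutualSigns i j ≡ D'.mutualSigns i j [ZMOD n] := by
  induction h with
  | rel _ _ h =>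
    rcases h with h | h
    · rw [← GaussDiagram.linking_add_linking, ← GaussDiagram.linking_add_linking,
        h.linking_eq hij, h.linking_eq hij.symm]
    · exact h.mutualSigns_modEq i j
  | refl _ => rfl
  | symm _ _ _ ih => exact ih.symm
  | trans _ _ _ _ _ ih ih' => exact ih.trans ih'

/-! ### Diagrams from lists of arrows -/

/-- An arrow of a Gauss diagram: the circle of its overpass, the circle of its underpass, and its
sign. -/
abbrev Arrow (μ : ℕ) : Type := Fin μ × Fin μ × ℤˣ

/-- The passages of the arrow `c.2` with name `c.1` on the `i`-th circle. -/
def arrowPassages {μ : ℕ} (i : Fin μ) (c : ℕ × Arrow μ) : List Passage :=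
  (if c.2.1 = i then [(c.1, true, c.2.2.2)] else []) ++
    (if c.2.2.1 = i then [(c.1, false, c.2.2.2)] else [])

/-- The words of the Gauss diagram with the named arrows `L`, arranged in the order of the list. -/
def arrowWord {μ : ℕ} (L : List (ℕ × Arrow μ)) (i : Fin μ) : List Passage :=
  L.flatMap (arrowPassages i)

theorem totalPassages_arrowWord {μ : ℕ} (L : List (ℕ × Arrow μ)) :
    totalPassages (arrowWord L) =
      (L.map (fun c => ((c.1, true, c.2.2.2) : Passage)) : Multiset Passage) +
        (L.map (fun c => ((c.1, !true, c.2.2.2) : Passage)) : Multiset Passage) := by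
  induction L with
  | nil => simp [totalPassages, arrowWord]
  | cons c L ih =>
    have hone : ∀ (a : Fin μ) (l : Passage),
        ∑ i, ((if a = i then [l] else [] : List Passage) : Multiset Passage) = {l} := by
      intro a l
      rw [Finset.sum_eq_single a] <;> simp +contextual [eq_comm]
    have : totalPassages (arrowWord (c :: L)) =
        ({(c.1, true, c.2.2.2)} + {(c.1, false, c.2.2.2)}) + totalPassages (arrowWord L) := by
      simp only [totalPassages, arrowWord, List.flatMap_cons, ← Multiset.coe_add,
        Finset.sum_add_distrib, arrowPassages, hone]
    rw [this, ih]
    simp only [List.map_cons, ← Multiset.cons_coe, ← Multiset.singleton_add, Bool.not_true]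
    abel

/-- The Gauss diagram with the named arrows `L`, arranged in the order of the list. -/
def GaussDiagram.ofArrows {μ : ℕ} (L : List (ℕ × Arrow μ)) (h : (L.map Prod.fst).Nodup) :
    GaussDiagram μ :=
  have hw : ∃ D : GaussDiagram μ, D.word = arrowWord L := by
    rw [exists_word_eq_iff, totalPassages_arrowWord]
    exact pairedPassages_map L Prod.fst (fun _ => true) (fun c => c.2.2.2) h
  { word := arrowWord L
    nodup := by obtain ⟨D, hD⟩ := hw; exact hD ▸ D.nodup
    disjoint := by obtain ⟨D, hD⟩ := hw; exact hD ▸ D.disjoint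
    mate_mem := by obtain ⟨D, hD⟩ := hw; exact hD ▸ D.mate_mem }

theorem GaussDiagram.ofArrows_word {μ : ℕ} {L : List (ℕ × Arrow μ)}
    (h : (L.map Prod.fst).Nodup) : (GaussDiagram.ofArrows L h).word = arrowWord L := rfl

theorem VRelated.ofArrows_perm {μ n : ℕ} (hn : Odd n) {L L' : List (ℕ × Arrow μ)}
    (h : (L.map Prod.fst).Nodup) (h' : (L'.map Prod.fst).Nodup) (hL : L.Perm L') :
    VRelated n (.ofArrows L h) (.ofArrows L' h') :=
  .of_perm hn fun i => hL.flatMap_right (arrowPassages i)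

/-- The names of the arrows do not matter. -/
theorem VRelated.ofArrows_rename {μ n : ℕ} {L L' : List (ℕ × Arrow μ)}
    (h : (L.map Prod.fst).Nodup) (h' : (L'.map Prod.fst).Nodup)
    (hL : L.map Prod.snd = L'.map Prod.snd) :
    VRelated n (.ofArrows L h) (.ofArrows L' h') := by
  have hlen : L.length = L'.length := by simpa using congrArg List.length hL
  obtain ⟨σ, hσ⟩ : ∃ σ : Equiv.Perm ℕ, (L.map Prod.fst).map σ = L'.map Prod.fst := by
    let e : {x // x ∈ L.map Prod.fst} ≃ {x // x ∈ L'.map Prod.fst} :=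
      (List.Nodup.getEquiv _ h).symm.trans
        ((finCongr (by simp [hlen])).trans (List.Nodup.getEquiv _ h'))
    have : Finite ↑{x | x ∈ L.map Prod.fst} := List.finite_toSet (L.map Prod.fst)
    refine ⟨e.extendSubtype, List.ext_getElem (by simp [hlen]) fun k hk hk' => ?_⟩
    rw [List.getElem_map]
    have hk0 : k < (L.map Prod.fst).length := by simpa using hk
    rw [Equiv.extendSubtype_apply_of_mem e _ (List.getElem_mem hk0)]
    have : (⟨(L.map Prod.fst)[k], List.getElem_mem hk0⟩ : {x // x ∈ L.map Prod.fst}) =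
        List.Nodup.getEquiv _ h ⟨k, hk0⟩ := rfl
    rw [this]
    simp only [e, Equiv.trans_apply, Equiv.symm_apply_apply]
    rfl
  have hL' : L' = L.map fun c => (σ c.1, c.2) := by
    refine List.ext_getElem (by simp [hlen]) fun k hk hk' => ?_
    have hk0 : k < L.length := by simpa using hk'
    have h1 : σ L[k].1 = L'[k].1 := by
      have := List.getElem_of_eq hσ (i := k) (by simpa using hk0)
      simpa using this
    have h2 : L[k].2 = L'[k].2 := by
      have := List.getElem_of_eq hL (i := k) (by simpa using hk0)
      simpa using this
    rw [List.getElem_map, h1, h2]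
  refine .of_welded (.rename σ fun i => ?_)
  rw [GaussDiagram.ofArrows_word, GaussDiagram.ofArrows_word, hL', arrowWord, arrowWord,
    List.map_flatMap, List.flatMap_map]
  refine List.flatMap_congr fun c _ => ?_
  simp only [arrowPassages, List.map_append]
  split_ifs <;> rfl

/-- Up to `V(n)`-moves, `D` has the multiset `m` of arrows. -/
def Realizes {μ : ℕ} (n : ℕ) (D : GaussDiagram μ) (m : Multiset (Arrow μ)) : Prop :=
  ∃ (L : List (ℕ × Arrow μ)) (h : (L.map Prod.fst).Nodup),
    (L.map Prod.snd : Multiset (Arrow μ)) = m ∧ VRelated n D (.ofArrows L h)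

theorem Realizes.vRelated {μ n : ℕ} (hn : Odd n) {D D' : GaussDiagram μ}
    {m : Multiset (Arrow μ)} (h : Realizes n D m) (h' : Realizes n D' m) : VRelated n D D' := by
  obtain ⟨L, hL, rfl, hD⟩ := h
  obtain ⟨L', hL', hm, hD'⟩ := h'
  obtain ⟨L'', hp, hL''⟩ : ∃ L'', L'.Perm L'' ∧ L''.map Prod.snd = L.map Prod.snd := by
    have h1 : Relation.Comp (fun l r => l = r.map Prod.snd) List.Perm (L.map Prod.snd) L' := by
      rw [List.eq_map_comp_perm]
      exact (Multiset.coe_eq_coe.1 hm).symm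
    obtain ⟨L'', h2, h3⟩ := h1
    exact ⟨L'', h3.symm, h2.symm⟩
  have hnd : (L''.map Prod.fst).Nodup := (hp.map Prod.fst).nodup_iff.1 hL'
  exact ((hD.trans (.ofArrows_rename hL hnd hL''.symm)).trans
    (.ofArrows_perm hn hnd hL' hp.symm)).trans hD'.symm

theorem Realizes.of_vRelated {μ n : ℕ} {D D' : GaussDiagram μ} {m : Multiset (Arrow μ)}
    (h : Realizes n D m) (h' : VRelated n D' D) : Realizes n D' m := by
  obtain ⟨L, hL, hm, hD⟩ := h
  exact ⟨L, hL, hm, h'.trans hD⟩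

theorem mem_arrowWord {μ : ℕ} {L : List (ℕ × Arrow μ)} {i : Fin μ} {l : Passage} :
    l ∈ arrowWord L i ↔ ∃ c ∈ L, c.1 = l.1 ∧ c.2.2.2 = l.2.2 ∧
      (if l.2.1 then c.2.1 else c.2.2.1) = i := by
  obtain ⟨x, b, ε⟩ := l
  simp only [arrowWord, List.mem_flatMap, arrowPassages, List.mem_append]
  refine exists_congr fun c => and_congr_right fun _ => ?_
  cases b <;> split_ifs <;> simp_all [eq_comm]

/-- Every diagram has the arrows of some list. -/
theorem exists_perm_ofArrows {μ : ℕ} (D : GaussDiagram μ) :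
    ∃ (L : List (ℕ × Arrow μ)) (h : (L.map Prod.fst).Nodup),
      ∀ i, (D.word i).Perm ((GaussDiagram.ofArrows L h).word i) := by
  obtain ⟨M, hM⟩ := exists_forall_fst_lt D
  let S : Finset (ℕ × Arrow μ) :=
    (Finset.range M ×ˢ Finset.univ).filter fun c =>
      ((c.1, true, c.2.2.2) : Passage) ∈ D.word c.2.1 ∧
        ((c.1, false, c.2.2.2) : Passage) ∈ D.word c.2.2.1
  have hS : ∀ c, c ∈ S ↔ ((c.1, true, c.2.2.2) : Passage) ∈ D.word c.2.1 ∧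
      ((c.1, false, c.2.2.2) : Passage) ∈ D.word c.2.2.1 := by
    intro c
    simp only [S, Finset.mem_filter, Finset.mem_product, Finset.mem_range, Finset.mem_univ,
      and_true, and_iff_right_iff_imp]
    exact fun h => hM _ _ h.1
  have hnd : (S.toList.map Prod.fst).Nodup := by
    refine (Finset.nodup_toList S).map_on fun c hc d hd hcd => ?_
    rw [Finset.mem_toList, hS] at hc hd
    have h1 := D.eq_of_key_eq hc.1 hd.1 (by simp [Passage.key, hcd])
    have h2 := D.eq_of_key hc.1 hd.1 (by simp [Passage.key, hcd])
    have h3 := D.eq_of_key hc.2 hd.2 (by simp [Passage.key, hcd])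
    simp only [Prod.mk.injEq, true_and] at h1
    ext1
    · exact hcd
    · ext1
      · exact h2
      · ext1
        · exact h3
        · exact h1.2
  refine ⟨S.toList, hnd, fun i => ?_⟩
  rw [List.perm_ext_iff_of_nodup (D.nodup i).of_map (GaussDiagram.nodup _ i).of_map]
  intro l
  rw [GaussDiagram.ofArrows_word, mem_arrowWord]
  constructor
  · intro hl
    obtain ⟨j, hj⟩ := D.mate_mem i l hl
    obtain ⟨x, b, ε⟩ := l
    cases b
    · exact ⟨(x, j, i, ε), by rw [Finset.mem_toList, hS]; exact ⟨hj, hl⟩, rfl, rfl, by simp⟩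
    · exact ⟨(x, i, j, ε), by rw [Finset.mem_toList, hS]; exact ⟨hl, hj⟩, rfl, rfl, by simp⟩
  · rintro ⟨c, hc, h1, h2, h3⟩
    rw [Finset.mem_toList, hS] at hc
    obtain ⟨x, b, ε⟩ := l
    dsimp only at h1 h2 h3
    subst h1 h2
    cases b
    · simp only [Bool.false_eq_true, if_false] at h3
      exact h3 ▸ hc.2
    · simp only [if_true] at h3
      exact h3 ▸ hc.1

/-- The contribution of an arrow to the sum of the two linking numbers of the circles `i`, `j`. -/
def Arrow.mutualSign {μ : ℕ} (i j : Fin μ) (c : Arrow μ) : ℤ :=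
  (if c.1 = i ∧ c.2.1 = j then (c.2.2 : ℤ) else 0) +
    if c.2.1 = i ∧ c.1 = j then (c.2.2 : ℤ) else 0

theorem mutualSigns_ofArrows {μ : ℕ} {L : List (ℕ × Arrow μ)} (h : (L.map Prod.fst).Nodup)
    (i j : Fin μ) : (GaussDiagram.ofArrows L h).mutualSigns i j =
      (L.map fun c => c.2.mutualSign i j).sum := by
  set D := GaussDiagram.ofArrows L h with hD
  have hw : D.word i = L.flatMap (arrowPassages i) := rfl
  rw [GaussDiagram.mutualSigns, hw, List.map_flatMap, List.flatMap_def, List.sum_flatten,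
    List.map_map]
  congr 1
  refine List.map_congr_left fun c hc => ?_
  have ho : ((c.1, true, c.2.2.2) : Passage) ∈ D.word c.2.1 :=
    mem_arrowWord.2 ⟨c, hc, rfl, rfl, by simp⟩
  have hu : ((c.1, false, c.2.2.2) : Passage) ∈ D.word c.2.2.1 :=
    mem_arrowWord.2 ⟨c, hc, rfl, rfl, by simp⟩
  have ho' : ((c.1, true, c.2.2.2) : Passage) ∈ D.word j ↔ c.2.1 = j :=
    ⟨fun hj => D.eq_of_key ho hj rfl, fun hj => hj ▸ ho⟩
  have hu' : ((c.1, false, c.2.2.2) : Passage) ∈ D.word j ↔ c.2.2.1 = j :=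
    ⟨fun hj => D.eq_of_key hu hj rfl, fun hj => hj ▸ hu⟩
  rw [Function.comp_apply, arrowPassages, List.map_append, List.sum_append, Arrow.mutualSign]
  congr 1
  · by_cases h1 : c.2.1 = i <;> simp [h1, Passage.mate, hu', Passage.sign]
  · by_cases h1 : c.2.2.1 = i <;> simp [h1, Passage.mate, ho', Passage.sign]

/-! ### Relations between arrows -/

/-- The diagram `w` with an open arc put at the beginning of the circle `a h`, for each `h`. -/
def openArcs {μ k : ℕ} (w : Fin μ → List Passage) (a : Fin k → Fin μ) : OpenDiagram μ k :=
  fun i => (List.finRange k).flatMap (fun h => if a h = i then [Sum.inr h] else []) ++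
    (w i).map Sum.inl

theorem fill_openArcs {μ k : ℕ} (w : Fin μ → List Passage) (a : Fin k → Fin μ)
    (f : Fin k → List Passage) (i : Fin μ) : (openArcs w a).fill f i =
      (List.finRange k).flatMap (fun h => if a h = i then f h else []) ++ w i := by
  simp only [OpenDiagram.fill, openArcs, List.flatMap_append, List.flatMap_assoc,
    List.flatMap_map, Sum.elim_inl, List.flatMap_singleton']
  congr 1
  refine List.flatMap_congr fun h _ => ?_
  split_ifs <;> simp

theorem sum_countP_openArcs {μ k : ℕ} (w : Fin μ → List Passage) (a : Fin k → Fin μ) (h : Fin k) :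
    ∑ i, (openArcs w a i).countP (fun s => s = Sum.inr h) = 1 := by
  have key : ∀ i, (openArcs w a i).countP (fun s => s = Sum.inr h) =
      if a h = i then 1 else 0 := by
    intro i
    have h1 : ((w i).map (Sum.inl : _ → Passage ⊕ Fin k)).countP (fun s => s = Sum.inr h) = 0 := by
      simp [List.countP_eq_zero]
    rw [openArcs, List.countP_append, h1, add_zero, List.countP_flatMap, ← Fin.sum_univ_def,
      Finset.sum_eq_single h]
    · rw [Function.comp_apply]
      split_ifs <;> simp
    · intro b _ hb
      rw [Function.comp_apply]
      split_ifs <;> simp [hb]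
    · simp
  simp [key]

/-- Arrows may be added to a diagram if some move introduces their passages `f`, placed as short
strands at the beginnings of the circles `a`. -/
theorem VRelated.ofArrows_append {μ n k : ℕ} (hn : Odd n) {L L₀ : List (ℕ × Arrow μ)}
    (h₀ : (L₀.map Prod.fst).Nodup) (h : ((L ++ L₀).map Prod.fst).Nodup) (a : Fin k → Fin μ)
    (f : Fin k → List Passage)
    (hL : ∀ i, ((List.finRange k).flatMap fun s => if a s = i then f s else []).Perm
      (arrowWord L i))
    (hmove : ∀ D D' : GaussDiagram μ, LocalChange (fun _ => []) f D D' → VRelated n D D') :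
    VRelated n (.ofArrows L₀ h₀) (.ofArrows (L ++ L₀) h) := by
  have hp : ∀ i, ((GaussDiagram.ofArrows (L ++ L₀) h).word i).Perm
      ((openArcs (arrowWord L₀) a).fill f i) := by
    intro i
    rw [fill_openArcs, GaussDiagram.ofArrows_word, arrowWord, List.flatMap_append]
    exact ((hL i).append_right _).symm
  obtain ⟨D, hD⟩ := GaussDiagram.exists_word_eq_of_perm _ hp
  refine (hmove _ D ⟨openArcs (arrowWord L₀) a, sum_countP_openArcs _ _, ?_, hD⟩).trans
    (.of_perm hn fun i => ?_)
  · funext i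
    rw [fill_openArcs]
    simp [GaussDiagram.ofArrows_word]
  · rw [hD]
    exact (hp i).symm

/-- A multiset of arrows can be given distinct names that are at least `N`. -/
theorem exists_names {μ : ℕ} (r : Multiset (Arrow μ)) (N : ℕ) :
    ∃ L : List (ℕ × Arrow μ), (L.map Prod.fst).Nodup ∧ (∀ c ∈ L, N ≤ c.1) ∧
      (L.map Prod.snd : Multiset (Arrow μ)) = r := by
  refine ⟨(r.toList.zipIdx N).map Prod.swap, ?_, ?_, ?_⟩
  · rw [List.map_map]
    have : (Prod.fst ∘ Prod.swap : Arrow μ × ℕ → ℕ) = Prod.snd := rfl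
    rw [this, List.zipIdx_map_snd]
    exact List.nodup_range'
  · intro c hc
    obtain ⟨d, hd, rfl⟩ := List.mem_map.1 hc
    exact List.le_snd_of_mem_zipIdx hd
  · rw [List.map_map]
    have : (Prod.snd ∘ Prod.swap : Arrow μ × ℕ → Arrow μ) = Prod.fst := rfl
    rw [this, List.zipIdx_map_fst, Multiset.coe_toList]

/-- Two multisets of arrows are congruent if they may be exchanged for each other in every
diagram. -/
def arrowCon (μ n : ℕ) : AddCon (Multiset (Arrow μ)) where
  r m m' := ∀ (r : Multiset (Arrow μ)) (D : GaussDiagram μ),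
    Realizes n D (m + r) ↔ Realizes n D (m' + r)
  iseqv := ⟨fun _ _ _ => Iff.rfl, fun h r D => (h r D).symm, fun h h' r D =>
    (h r D).trans (h' r D)⟩
  add' {m m' k k'} h h' r D := by
    rw [add_assoc, h, add_left_comm, h', add_left_comm, add_assoc]

/-- It is enough to compare one naming of the arrows. -/
theorem arrowCon_of_lists {μ n : ℕ} (hn : Odd n) {m m' : Multiset (Arrow μ)}
    (L L' : List (ℕ × Arrow μ)) (hm : (L.map Prod.snd : Multiset (Arrow μ)) = m)
    (hm' : (L'.map Prod.snd : Multiset (Arrow μ)) = m') (hL : (L.map Prod.fst).Nodup)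
    (hL' : (L'.map Prod.fst).Nodup)
    (h : ∀ (L₀ : List (ℕ × Arrow μ)) (_ : (L₀.map Prod.fst).Nodup)
      (h : ((L ++ L₀).map Prod.fst).Nodup) (h' : ((L' ++ L₀).map Prod.fst).Nodup),
      VRelated n (.ofArrows (L ++ L₀) h) (.ofArrows (L' ++ L₀) h')) :
    arrowCon μ n m m' := by
  intro r D
  obtain ⟨N, hN⟩ : ∃ N, ∀ c ∈ L ++ L', c.1 < N := by
    refine ⟨((L ++ L').map Prod.fst).toFinset.sup id + 1, fun c hc => ?_⟩
    refine Nat.lt_succ_of_le (Finset.le_sup (f := id) ?_)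
    rw [List.mem_toFinset]
    exact List.mem_map_of_mem hc
  obtain ⟨L₀, h₀, hL₀, rfl⟩ := exists_names r N
  have key : ∀ K : List (ℕ × Arrow μ), (K.map Prod.fst).Nodup → (∀ c ∈ K, c.1 < N) →
      ((K ++ L₀).map Prod.fst).Nodup := by
    intro K hK hKN
    rw [List.map_append, List.nodup_append]
    refine ⟨hK, h₀, fun x hx y hy => ?_⟩
    obtain ⟨c, hc, rfl⟩ := List.mem_map.1 hx
    obtain ⟨d, hd, rfl⟩ := List.mem_map.1 hy
    exact ((hKN c hc).trans_le (hL₀ d hd)).ne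
  have k1 := key L hL fun c hc => hN c (List.mem_append_left _ hc)
  have k2 := key L' hL' fun c hc => hN c (List.mem_append_right _ hc)
  have hrel := h L₀ h₀ k1 k2
  have r1 : Realizes n (.ofArrows (L ++ L₀) k1) (m + (L₀.map Prod.snd : List (Arrow μ))) :=
    ⟨L ++ L₀, k1, by rw [List.map_append, ← Multiset.coe_add, hm], .refl _⟩
  have r2 : Realizes n (.ofArrows (L' ++ L₀) k2) (m' + (L₀.map Prod.snd : List (Arrow μ))) :=
    ⟨L' ++ L₀, k2, by rw [List.map_append, ← Multiset.coe_add, hm'], .refl _⟩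
  exact ⟨fun hD => r2.of_vRelated ((hD.vRelated hn r1).trans hrel),
    fun hD => r1.of_vRelated ((hD.vRelated hn r2).trans hrel.symm)⟩

/-- Reversal of an arrow, by half twists. -/
theorem arrowCon_reverse {μ n : ℕ} (hn : Odd n) (a b : Fin μ) (ε : ℤˣ) :
    arrowCon μ n {(a, b, ε)} {(b, a, ε)} := by
  refine arrowCon_of_lists hn [(0, a, b, ε)] [(0, b, a, ε)] rfl rfl (by simp) (by simp)
    fun L₀ h₀ h h' => (VRelated.flip hn _ {0}).trans (.of_perm hn fun i => ?_)
  have hL₀ : ∀ l ∈ arrowWord L₀ i, l.flip {0} = l := by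
    intro l hl
    obtain ⟨c, hc, hcl, -⟩ := mem_arrowWord.1 hl
    have : l.1 ≠ 0 := fun h0 => by
      simp only [List.cons_append, List.nil_append, List.map_cons, List.nodup_cons] at h
      exact h.1 (List.mem_map.2 ⟨c, hc, hcl.trans h0⟩)
    simp [Passage.flip, this]
  have e : ∀ c, arrowWord ([c] ++ L₀) i = arrowPassages i c ++ arrowWord L₀ i := by
    intro c
    simp [arrowWord]
  simp only [GaussDiagram.flip, GaussDiagram.ofArrows_word, e, List.map_append]
  rw [List.map_congr_left hL₀, List.map_id']
  refine List.Perm.append_right _ ?_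
  by_cases ha : a = i <;> by_cases hb : b = i <;>
    simp [arrowPassages, ha, hb, Passage.flip, Passage.mate, List.Perm.swap]

/-- An arrow from a circle to itself is removed by R1. -/
theorem arrowCon_self {μ n : ℕ} (hn : Odd n) (a : Fin μ) (ε : ℤˣ) :
    arrowCon μ n {(a, a, ε)} 0 := by
  refine arrowCon_of_lists hn [(0, a, a, ε)] [] rfl rfl (by simp) (by simp)
    fun L₀ h₀ h h' => (VRelated.ofArrows_append hn h₀ h (k := 1) ![a]
      ![[(0, true, ε), (0, false, ε)]] (fun i => ?_) fun D D' hD => ?_).symm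
  · by_cases ha : a = i <;> simp [arrowWord, arrowPassages, ha, List.finRange_succ]
  · refine .of_welded (.r1_over 0 ε ?_)
    have : (![[]] : Fin 1 → List Passage) = fun _ => [] := by
      funext s; fin_cases s; rfl
    rw [this]
    exact hD

/-- Parallel arrows of opposite signs are removed by R2. -/
theorem arrowCon_cancel {μ n : ℕ} (hn : Odd n) (a b : Fin μ) (ε : ℤˣ) :
    arrowCon μ n ({(a, b, ε)} + {(a, b, -ε)}) 0 := by
  refine arrowCon_of_lists hn [(0, a, b, ε), (1, a, b, -ε)] [] rfl rfl (by simp) (by simp)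
    fun L₀ h₀ h h' => (VRelated.ofArrows_append hn h₀ h (k := 2) ![a, b]
      ![[(0, true, ε), (1, true, -ε)], [(0, false, ε), (1, false, -ε)]]
      (fun i => ?_) fun D D' hD => ?_).symm
  · by_cases ha : a = i <;> by_cases hb : b = i <;>
      simp [arrowWord, arrowPassages, ha, hb, List.finRange_succ, List.Perm.swap]
  · refine .of_welded (.r2_parallel 0 1 ε ?_)
    have : (![[], []] : Fin 2 → List Passage) = fun _ => [] := by
      funext s; fin_cases s <;> rfl
    rw [this]
    exact hD

/-- The arrows of a `V(n)`-move, alternately from `a` to `b` and from `b` to `a`. -/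
theorem arrowCon_alternating {μ n : ℕ} (hn : Odd n) (a b : Fin μ) (ε : ℤˣ) :
    arrowCon μ n ((List.range n).map fun k => if Odd k then (b, a, ε) else (a, b, ε) :
      List (Arrow μ)) 0 := by
  refine arrowCon_of_lists hn
    ((List.range n).map fun k => (k, if Odd k then (b, a, ε) else (a, b, ε))) []
    (by simp [Function.comp_def]) rfl (by simp [Function.comp_def, List.nodup_range]) (by simp)
    fun L₀ h₀ h h' => (VRelated.ofArrows_append hn h₀ h (k := 2) ![a, b]
      ![twistStrand n id true ε, twistStrand n id false ε]
      (fun i => ?_) fun D D' hD => ?_).symm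
  · have e : ∀ (c : Fin μ) (d : Bool), (if c = i then twistStrand n id d ε else []) =
        (List.range n).flatMap fun k =>
          if c = i then [((k, d ^^ decide (Odd k), ε) : Passage)] else [] := by
      intro c d
      split_ifs
      · rw [twistStrand, List.map_eq_flatMap]
        rfl
      · simp
    have e2 : ((List.finRange 2).flatMap fun s : Fin 2 => if (![a, b] : Fin 2 → Fin μ) s = i then
        (![twistStrand n id true ε, twistStrand n id false ε] : Fin 2 → List Passage) s else []) =
        (if a = i then twistStrand n id true ε else []) ++
          (if b = i then twistStrand n id false ε else []) := by
      simp only [List.finRange_succ, List.flatMap_cons, List.finRange_zero, List.map_nil,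
        List.map_cons, List.flatMap_nil, List.append_nil]
      rfl
    rw [e2, e, e, arrowWord, List.flatMap_map]
    refine (List.flatMap_append_perm _ _ _).trans (List.Perm.flatMap_left _ fun k _ => ?_)
    by_cases hk : Odd k <;> by_cases ha : a = i <;> by_cases hb : b = i <;>
      simp [arrowPassages, hk, ha, hb, List.Perm.swap]
  · refine .of_vMove (vMove_of_localChange id true ε ?_)
    have : (![[], []] : Fin 2 → List Passage) = fun _ => [] := by
      funext s; fin_cases s <;> rfl
    rw [this]
    exact hD

/-! ### Classification -/

/-- A weight of arrows by natural numbers that is congruent to `Arrow.mutualSign` modulo `n`. -/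
def Arrow.weight {μ : ℕ} (n : ℕ) (i j : Fin μ) (c : Arrow μ) : ℕ :=
  if (c.1 = i ∧ c.2.1 = j) ∨ (c.2.1 = i ∧ c.1 = j) then (if c.2.2 = 1 then 1 else n - 1) else 0

theorem Arrow.weight_modEq {μ n : ℕ} (hn : Odd n) {i j : Fin μ} (hij : i ≠ j) (c : Arrow μ) :
    (c.weight n i j : ℤ) ≡ c.mutualSign i j [ZMOD n] := by
  obtain ⟨a, b, ε⟩ := c
  have hε : (((if ε = 1 then 1 else n - 1 : ℕ) : ℕ) : ℤ) ≡ ε [ZMOD n] := by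
    rcases Int.units_eq_one_or ε with rfl | rfl
    · rfl
    · have : (-1 : ℤˣ) ≠ 1 := by decide
      rw [if_neg this, Nat.cast_sub hn.pos]
      exact (Int.modEq_iff_dvd).2 ⟨-1, by push_cast; ring⟩
  unfold Arrow.weight Arrow.mutualSign
  dsimp only
  by_cases h1 : a = i ∧ b = j
  · have h2 : ¬ (b = i ∧ a = j) := fun h => hij (h1.1.symm.trans h.2)
    rw [if_pos (Or.inl h1), if_pos h1, if_neg h2, add_zero]
    exact hε
  · by_cases h2 : b = i ∧ a = j
    · rw [if_pos (Or.inr h2), if_neg h1, if_pos h2, zero_add]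
      exact hε
    · rw [if_neg (not_or.2 ⟨h1, h2⟩), if_neg h1, if_neg h2]
      rfl

theorem nsmul_mk_singleton_eq_zero {μ n : ℕ} (hn : Odd n) (a b : Fin μ) (ε : ℤˣ) :
    n • (arrowCon μ n).mk' {(a, b, ε)} = 0 := by
  have h1 := (AddCon.eq _).2 (arrowCon_alternating (n := n) hn a b ε)
  have h2 : (arrowCon μ n).mk' {(b, a, ε)} = (arrowCon μ n).mk' {(a, b, ε)} :=
    (AddCon.eq _).2 (arrowCon_reverse hn b a ε)
  have h3 : ∀ l : List ℕ, (arrowCon μ n).mk'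
      ((l.map fun k => if Odd k then (b, a, ε) else (a, b, ε) : List (Arrow μ)) :
        Multiset (Arrow μ)) = l.length • (arrowCon μ n).mk' {(a, b, ε)} := by
    intro l
    induction l with
    | nil => simp
    | cons k l ih =>
      rw [List.map_cons, ← Multiset.cons_coe, ← Multiset.singleton_add, map_add, ih,
        List.length_cons, succ_nsmul']
      split_ifs <;> simp only [h2]
  have h4 := h3 (List.range n)
  rw [List.length_range] at h4
  exact h4.symm.trans h1

theorem mk_singleton_eq_nsmul {μ n : ℕ} (hn : Odd n) (a b : Fin μ) (ε : ℤˣ) :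
    (arrowCon μ n).mk' {(a, b, ε)} =
      (if ε = 1 then 1 else n - 1) • (arrowCon μ n).mk' {(a, b, 1)} := by
  rcases Int.units_eq_one_or ε with rfl | rfl
  · simp
  · have h : (-1 : ℤˣ) ≠ 1 := by decide
    have h1 : (arrowCon μ n).mk' ({(a, b, 1)} + {(a, b, -1)}) = 0 :=
      (AddCon.eq _).2 (arrowCon_cancel hn a b 1)
    rw [map_add] at h1
    have h2 := nsmul_mk_singleton_eq_zero (n := n) hn a b 1
    obtain ⟨k, rfl⟩ : ∃ k, n = k + 1 := ⟨n - 1, (Nat.sub_add_cancel hn.pos).symm⟩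
    rw [if_neg h, Nat.add_sub_cancel]
    rw [succ_nsmul] at h2
    rw [← zero_add ((arrowCon μ (k + 1)).mk' {(a, b, -1)}), ← h2, add_assoc, h1, add_zero]

/-- Normal form of a multiset of arrows: positive arrows that point from circles of smaller index to
circles of larger index. -/
theorem mk_eq_sum_weight {μ n : ℕ} (hn : Odd n) (m : Multiset (Arrow μ)) :
    (arrowCon μ n).mk' m = ∑ p ∈ (Finset.univ : Finset (Fin μ × Fin μ)).filter fun p => p.1 < p.2,
      (m.map (Arrow.weight n p.1 p.2)).sum • (arrowCon μ n).mk' {(p.1, p.2, 1)} := by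
  induction m using Multiset.induction_on with
  | empty => simp
  | cons c m ih =>
    rw [← Multiset.singleton_add, map_add, ih]
    simp only [Multiset.map_add, Multiset.sum_add, add_smul, Finset.sum_add_distrib,
      Multiset.map_singleton, Multiset.sum_singleton]
    congr 1
    obtain ⟨a, b, ε⟩ := c
    rcases lt_trichotomy a b with hab | rfl | hab
    · rw [Finset.sum_eq_single (a, b), mk_singleton_eq_nsmul hn]
      · simp [Arrow.weight]
      · rintro ⟨i, j⟩ hp hne
        have hij : i < j := by simpa using hp
        have : ¬ ((a = i ∧ b = j) ∨ (b = i ∧ a = j)) := by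
          rintro (⟨rfl, rfl⟩ | ⟨rfl, rfl⟩)
          · exact hne rfl
          · exact absurd hij hab.asymm
        simp [Arrow.weight, this]
      · simp [hab]
    · rw [Finset.sum_eq_zero]
      · exact (AddCon.eq _).2 (arrowCon_self hn a ε)
      · rintro ⟨i, j⟩ hp
        have hij : i < j := by simpa using hp
        have : ¬ ((a = i ∧ a = j) ∨ (a = i ∧ a = j)) := by
          rintro (⟨rfl, rfl⟩ | ⟨rfl, rfl⟩) <;> exact lt_irrefl _ hij
        simp only [Arrow.weight, if_neg this, zero_smul]
    · rw [Finset.sum_eq_single (b, a)]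
      · have h : (arrowCon μ n).mk' {(a, b, ε)} = (arrowCon μ n).mk' {(b, a, ε)} :=
          (AddCon.eq _).2 (arrowCon_reverse hn a b ε)
        rw [h, mk_singleton_eq_nsmul hn]
        simp [Arrow.weight]
      · rintro ⟨i, j⟩ hp hne
        have hij : i < j := by simpa using hp
        have : ¬ ((a = i ∧ b = j) ∨ (b = i ∧ a = j)) := by
          rintro (⟨rfl, rfl⟩ | ⟨rfl, rfl⟩)
          · exact absurd hij hab.asymm
          · exact hne rfl
        simp [Arrow.weight, this]
      · simp [hab]

theorem arrowCon_of_modEq {μ n : ℕ} (hn : Odd n) {m m' : Multiset (Arrow μ)}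
    (h : ∀ i j : Fin μ, i < j → (m.map (Arrow.mutualSign i j)).sum ≡
      (m'.map (Arrow.mutualSign i j)).sum [ZMOD n]) : arrowCon μ n m m' := by
  have hw : ∀ (i j : Fin μ), i < j → ∀ m : Multiset (Arrow μ),
      (((m.map (Arrow.weight n i j)).sum : ℕ) : ℤ) ≡ (m.map (Arrow.mutualSign i j)).sum
        [ZMOD n] := by
    intro i j hij m
    induction m using Multiset.induction_on with
    | empty => simp
    | cons c m ih =>
      rw [Multiset.map_cons, Multiset.map_cons, Multiset.sum_cons, Multiset.sum_cons,
        Nat.cast_add]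
      exact (c.weight_modEq hn hij.ne).add ih
  refine (AddCon.eq _).1 ?_
  change (arrowCon μ n).mk' m = (arrowCon μ n).mk' m'
  rw [mk_eq_sum_weight hn m, mk_eq_sum_weight hn m']
  refine Finset.sum_congr rfl fun p hp => ?_
  have hp : p.1 < p.2 := by simpa using hp
  refine nsmul_eq_nsmul_of_modEq ?_ (nsmul_mk_singleton_eq_zero hn p.1 p.2 1)
  exact (Int.natCast_modEq_iff).1 (((hw _ _ hp m).trans (h _ _ hp)).trans (hw _ _ hp m').symm)

/-- Equality of the invariants modulo `n` suffices: both diagrams are arranged as lists of arrows,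
which are congruent by their normal forms. -/
theorem VRelated.of_mutualSigns {μ n : ℕ} (hn : Odd n) {D D' : GaussDiagram μ}
    (h : ∀ i j : Fin μ, i < j → D.mutualSigns i j ≡ D'.mutualSigns i j [ZMOD n]) :
    VRelated n D D' := by
  obtain ⟨L, hL, hp⟩ := exists_perm_ofArrows D
  obtain ⟨L', hL', hp'⟩ := exists_perm_ofArrows D'
  have hD := VRelated.of_perm hn hp
  have hD' := VRelated.of_perm hn hp'
  have hsum : ∀ (K : List (ℕ × Arrow μ)) (hK : (K.map Prod.fst).Nodup) (i j : Fin μ),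
      (((K.map Prod.snd : List (Arrow μ)) : Multiset (Arrow μ)).map (Arrow.mutualSign i j)).sum =
        (GaussDiagram.ofArrows K hK).mutualSigns i j := by
    intro K hK i j
    rw [mutualSigns_ofArrows, Multiset.map_coe, Multiset.sum_coe, List.map_map]
    rfl
  have hcon : arrowCon μ n (L.map Prod.snd : List (Arrow μ)) (L'.map Prod.snd : List (Arrow μ)) := by
    refine arrowCon_of_modEq hn fun i j hij => ?_
    rw [hsum L hL, hsum L' hL']
    exact ((hD.mutualSigns_modEq hij.ne).symm.trans (h i j hij)).trans
      (hD'.mutualSigns_modEq hij.ne)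
  have hr : Realizes n D ((L.map Prod.snd : List (Arrow μ)) + 0) := ⟨L, hL, by simp, hD⟩
  have hr' : Realizes n D' ((L'.map Prod.snd : List (Arrow μ)) + 0) := ⟨L', hL', by simp, hD'⟩
  exact ((hcon 0 D).1 hr).vRelated hn hr'

theorem theorem1p2 (μ n : ℕ) (hn : Odd n) (L L' : WeldedLink μ) :
    VEquivalent n L L' ↔
      ∀ (i j : Fin μ) (hij : i < j),
        L.linking i j hij.ne + L.linking j i hij.ne' ≡
          L'.linking i j hij.ne + L'.linking j i hij.ne' [ZMOD n] := by
  have hlink : ∀ (D : GaussDiagram μ) (i j : Fin μ) (hij : i < j),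
      WeldedLink.linking (Quotient.mk (weldedSetoid μ) D) i j hij.ne +
        WeldedLink.linking (Quotient.mk (weldedSetoid μ) D) j i hij.ne' = D.mutualSigns i j :=
    fun D i j _ => D.linking_add_linking i j
  constructor
  · rintro ⟨D, D', rfl, rfl, h⟩ i j hij
    rw [hlink D i j hij, hlink D' i j hij]
    exact VRelated.mutualSigns_modEq h hij.ne
  · intro h
    obtain ⟨D, rfl⟩ := Quotient.exists_rep L
    obtain ⟨D', rfl⟩ := Quotient.exists_rep L'
    refine ⟨D, D', rfl, rfl, VRelated.of_mutualSigns hn fun i j hij => ?_⟩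
    have := h i j hij
    rwa [hlink D i j hij, hlink D' i j hij] at this
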